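/- **Conventions.** Let $\sigma_3=\mathrm{diag}[1,-1]$ and $(\sigma g)(\lambda)=\sigma_3\,g(-\lambda)\,\sigma_3^{-1}$. For $r\in(0,1]$ let $C_r=\{|\lambda|=r\}$. Fix one of the following Banach algebras $\mathcal A_r$ of functions $f(\lambda)=\sum_{n\in\mathbb Z}a_n\lambda^n$ on $C_r$: the $H^s$-functions for some $s>1/2$ (norm $(\sum_n(1+n^2)^s|a_n|^2r^{2n})^{1/2}$), or a weighted Wiener algebra (norm $\sum_n w(n)|a_n|r^n$, with $w\ge1$, $w(m+n)\le w(m)w(n)$ and $w(n)^{1/|n|}\to1$). Let $\Lambda_r\mathrm{SL}_\sigma$ be the group of maps $g:C_r\to\mathrm{SL}(2,\mathbb C)$ with entries in $\mathcal A_r$ and $\sigma g=g$; a map into it is holomorphic if its entries are holomorphic maps into the Banach space $\mathcal A_r$. For $V\subset\mathbb C$ open let $\Lambda\Omega(V)$ be the set of forms $A(z,\lambda)\,dz$ with $A:V\times\mathbb C^*\to\mathfrak{sl}(2,\mathbb C)$ holomorphic, $A(z,\lambda)=\sum_{j\ge-1}A_j(z)\lambda^j$, and $\sigma A(z,\cdot)=A(z,\cdot)$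 for every $z\in V$. **Theorem.** Let $U_0\subset\mathbb C$ be open and simply connected with $0\in U_0$, and let $U_0^*=U_0\setminus\{0\}$. Let $\xi\in\Lambda\Omega(U_0^*)$ have a simple pole at $z=0$ with residue $$D(\lambda)=\begin{pmatrix}0&\alpha\lambda^{-1}+\beta\lambda\\ \beta\lambda^{-1}+\alpha\lambda&0\end{pmatrix},\qquad \alpha,\beta\in\mathbb R\setminus\{0\},$$ that is, $\xi=D\,\frac{dz}{z}+\eta$ with $\eta\in\Lambda\Omega(U_0)$. Assume that $D$ satisfies the first closing condition: $\exp(2\pi i D(\lambda_0))=\pm\mathrm{Id}$ for some $\lambda_0\in S^1$. Then there exist $r\in(0,1)$ and a map $P$ from $U_0$ to the loops on $C_r$ such that, for every one of the above choices of $\mathcal A_r$ (with the same $r$ and $P$), the following hold. 1. $P:U_0\to\Lambda_r\mathrm{SL}_\sigma$ is holomorphic. 2. In the coordinate $w=\log z$ on the universal cover $\widetilde U=\{w\in\mathbb C: e^w\in U_0\}$ of $U_0^*$, the map $\Psi=z^DP$, i.e. $\Psi(w,\lambda)=\exp(wD(\lambda))\,P(e^w,\lambda)$, is holomorphic from $\widetilde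 U$ to $\Lambda_r\mathrm{SL}_\sigma$ and solves $d\Psi=\Psi\xi$. 3. $\Psi$ has Delaunay monodromy: $\exp(2\pi iD)\in\Lambda_r\mathrm{SL}_\sigma$ and $\Psi(w+2\pi i,\lambda)=\exp(2\pi iD(\lambda))\,\Psi(w,\lambda)$ for all $w\in\widetilde U$ and $\lambda\in C_r$. 4. If $1\in U_0$, then $\Psi$ is the holomorphic frame associated with $(\xi,P(1),1)$: it is the unique holomorphic solution $\Phi:\widetilde U\to\Lambda_r\mathrm{SL}_\sigma$ of $d\Phi=\Phi\xi$ with $\Phi=P(1)$ at the point $w=0$ over $z=1$. -/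

import Mathlib

open Set Filter Topology
open scoped ENNReal

noncomputable section

namespace LoopODE

/-- Complex `2 × 2` matrices. -/
abbrev Mat : Type := Matrix (Fin 2) (Fin 2) ℂ

/-- `σ₃ = diag[1, -1]`. -/
def sigma3 : Mat := !![1, 0; 0, -1]

/-- The involution `σ` on matrix-valued functions of the loop parameter:
`(σ g)(lam) = σ₃ g(-lam) σ₃⁻¹`. -/
def twist (g : ℂ → Mat) : ℂ → Mat := fun lam => sigma3 * g (-lam) * sigma3⁻¹

/-! ### Loop groups

Functions of the loop parameter are functions on `ℂ` of which only the values on the circle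
`C_r = {|lam| = r}` matter. -/

/-- A weight for a weighted Wiener algebra on a circle: bounded below by `1`, submultiplicative,
and of subexponential growth (`w(n) ^ (1/|n|) → 1` as `|n| → ∞`). -/
structure IsWienerWeight (w : ℤ → ℝ) : Prop where
  one_le : ∀ n, 1 ≤ w n
  submul : ∀ m n, w (m + n) ≤ w m * w n
  subexp : Tendsto (fun n : ℤ => w n ^ (1 / |(n : ℝ)|)) cofinite (𝓝 1)

/-- The topologies put on loops: an `H^s` topology with `s > 1/2`, or a (weighted)
Wiener topology. -/
inductive LoopTopology : Type
  | sobolev (s : ℝ) (hs : 1 / 2 < s) : LoopTopology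
  | wiener (w : ℤ → ℝ) (hw : IsWienerWeight w) : LoopTopology

namespace LoopTopology

/-- The summability exponent: `2` for `H^s`, `1` for Wiener. -/
def exponent : LoopTopology → ℝ≥0∞
  | sobolev _ _ => 2
  | wiener _ _ => 1

/-- The weight of the `n`-th Fourier coefficient: `(1 + n²)^{s/2}` for `H^s`, `w n` for Wiener. -/
def weight : LoopTopology → ℤ → ℝ
  | sobolev s _ => fun n => (1 + (n : ℝ) ^ 2) ^ (s / 2)
  | wiener w _ => w

instance instFactExponent (T : LoopTopology) : Fact (1 ≤ T.exponent) := by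
  constructor
  cases T <;> simp [exponent]

/-- The Banach space `𝒜_r` of scalar functions `∑ a_n lam^n` on `C_r`, in the coordinates
`T.weight n * r^n * a_n`. With these coordinates the norm is
`(∑ (1 + n²)^s |r^n a_n|²)^{1/2}` for `H^s` and `∑ w(n) r^n |a_n|` for Wiener,
for every radius `r`. -/
abbrev Coeffs (T : LoopTopology) : Type := lp (fun _ : ℤ => ℂ) T.exponent

end LoopTopology

/-- The element `a` of the Banach space `𝒜_r` is the function `g` on the circle `C_r`. -/
def Represents (T : LoopTopology) (r : ℝ) (a : T.Coeffs) (g : ℂ → ℂ) : Prop :=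
  ∀ lam : ℂ, ‖lam‖ = r →
    HasSum (fun n : ℤ => a n / (T.weight n : ℂ) * (lam / (r : ℂ)) ^ n) (g lam)

/-- The twisted loop group `Λ_r SL(2,ℂ)_σ`: functions on `C_r` with values of determinant `1`,
fixed by the involution `σ`, all of whose entries belong to `𝒜_r`. -/
def loopGroup (T : LoopTopology) (r : ℝ) : Set (ℂ → Mat) :=
  {g | (∀ i j, ∃ a : T.Coeffs, Represents T r a (fun lam => g lam i j)) ∧
    (∀ lam : ℂ, ‖lam‖ = r → (g lam).det = 1) ∧
    (∀ lam : ℂ, ‖lam‖ = r → twist g lam = g lam)}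

/-- `Φ : V → Λ_r SL(2,ℂ)_σ` is holomorphic: `Φ z` is in the loop group for `z ∈ V`, and every
matrix entry is a complex differentiable map from `V` to the Banach space `𝒜_r`. -/
structure IsHolomorphicLoopMap (T : LoopTopology) (r : ℝ) (V : Set ℂ) (Φ : ℂ → ℂ → Mat) :
    Prop where
  mem : ∀ z ∈ V, Φ z ∈ loopGroup T r
  holo : ∀ i j, ∃ F : ℂ → T.Coeffs, DifferentiableOn ℂ F V ∧
    ∀ z ∈ V, Represents T r (F z) (fun lam => Φ z lam i j)

/-! ### Potentials -/

/-- `A(z, lam) dz` is an element of `ΛΩ(V)`: it is holomorphic on `V × ℂ^*`, has a Laurent expansion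
`∑_{j ≥ -1} A_j(z) lam^j` on `ℂ^*`, is trace-free and fixed by the involution `σ`. -/
structure IsPotential (V : Set ℂ) (A : ℂ → ℂ → Mat) : Prop where
  holo : ∀ i j, DifferentiableOn ℂ (fun p : ℂ × ℂ => A p.1 p.2 i j) (V ×ˢ {0}ᶜ)
  laurent : ∀ z ∈ V, ∃ c : ℕ → Mat, ∀ lam : ℂ, lam ≠ 0 →
    HasSum (fun j : ℕ => lam ^ ((j : ℤ) - 1) • c j) (A z lam)
  traceless : ∀ z ∈ V, ∀ lam : ℂ, lam ≠ 0 → (A z lam).trace = 0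
  twisted : ∀ z ∈ V, ∀ lam : ℂ, lam ≠ 0 → twist (A z) lam = A z lam

/-- The potential `A(z, lam) dz` on `U \ {0}` has a simple pole at `z = 0` with residue `D(lam)`:
`A = D / z + η` with `η dz ∈ ΛΩ(U)`. -/
def HasSimplePoleWithResidue (U : Set ℂ) (A : ℂ → ℂ → Mat) (D : ℂ → Mat) : Prop :=
  ∃ η : ℂ → ℂ → Mat, IsPotential U η ∧
    ∀ z ∈ U \ {0}, ∀ lam : ℂ, lam ≠ 0 → A z lam = z⁻¹ • D lam + η z lam

/-- The Delaunay residue. -/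
def delaunay (α β : ℝ) (lam : ℂ) : Mat :=
  !![0, (α : ℂ) * lam⁻¹ + (β : ℂ) * lam; (β : ℂ) * lam⁻¹ + (α : ℂ) * lam, 0]

/-- The Delaunay monodromy `exp(2πi D)`. -/
def delaunayMonodromy (α β : ℝ) (lam : ℂ) : Mat :=
  NormedSpace.exp ((2 * (Real.pi : ℂ) * Complex.I) • delaunay α β lam)

/-- First closing condition for a monodromy `χ`: `χ(lam₀) = ± Id` at some `lam₀ ∈ S¹`. -/
def FirstClosing (χ : ℂ → Mat) : Prop :=
  ∃ lam₀ : ℂ, ‖lam₀‖ = 1 ∧ (χ lam₀ = 1 ∨ χ lam₀ = -1)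

/-! ### Frames on the universal cover

For `U` open, simply connected and containing `0`, the universal cover of `U \ {0}` is
`{w | exp w ∈ U}` with covering map `z = exp w`; its deck group is generated by
`w ↦ w + 2πi`. -/

/-- The universal cover of `U \ {0}` in the logarithmic coordinate `w`, `z = exp w`. -/
def logCover (U : Set ℂ) : Set ℂ := Complex.exp ⁻¹' U

/-- The coefficient of `dw` in the pull back of `A(z, lam) dz` under `z = exp w`. -/
def pullbackExp (A : ℂ → ℂ → Mat) : ℂ → ℂ → Mat :=
  fun w lam => Complex.exp w • A (Complex.exp w) lam

/-- `Φ : V → Λ_r SL(2,ℂ)_σ` is a holomorphic solution of `dΦ = Φ A dw` on `V`. -/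
structure IsHolomorphicFrame (T : LoopTopology) (r : ℝ) (V : Set ℂ) (A Φ : ℂ → ℂ → Mat) :
    Prop where
  loopMap : IsHolomorphicLoopMap T r V Φ
  ode : ∀ w ∈ V, ∀ lam : ℂ, ‖lam‖ = r → ∀ i j,
    HasDerivAt (fun u => Φ u lam i j) ((Φ w lam * A w lam) i j) w

/-- `ρ ∈ Λ_r SL(2,ℂ)_σ` is a monodromy of `Φ` with respect to the translation by `τ`:
`Φ(w + τ) = ρ Φ(w)`. -/
def IsMonodromy (T : LoopTopology) (r : ℝ) (V : Set ℂ) (Φ : ℂ → ℂ → Mat) (τ : ℂ)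
    (ρ : ℂ → Mat) : Prop :=
  ρ ∈ loopGroup T r ∧
    ∀ w ∈ V, w + τ ∈ V ∧ ∀ lam : ℂ, ‖lam‖ = r → Φ (w + τ) lam = ρ lam * Φ w lam

/-- `z^D P` in the logarithmic coordinate: `exp(w D(lam)) P(exp w, lam)`. -/
def zPow (D : ℂ → Mat) (P : ℂ → ℂ → Mat) : ℂ → ℂ → Mat :=
  fun w lam => NormedSpace.exp (w • D lam) * P (Complex.exp w) lam

end LoopODE

end

namespace LoopODE

/-! ### Injective holomorphic functions -/

/-! The frame is sought as Ψ = z^D P with P single-valued on the whole domain. For ξ = D dz/z + η,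
the equation dΨ = Ψξ is equivalent to z P' = z P η + (P D − D P). This linear system has a regular
singular point at 0, with leading operator X ↦ X D − D X. The initial value P(0) = Id lies in the
kernel of that operator, so there is exactly one holomorphic solution as soon as no positive integer
is an eigenvalue. Because D² = μ² Id (`delaunay_mul_self`), the eigenvalues are among 0 and ±2μ
(`commutator_cube`), and the condition is 4μ(λ)² ≠ k² for k ≥ 1. The monodromy of Ψ is then that of
z^D alone.

Resonance is avoided by the choice of radius. Put δ = 4(α² + β²), so that 4μ² = 4αβ(λ² + λ⁻²) + δ.
For 0 < |λ| < 1 this is real only if λ² is real, so resonant radii ρ satisfy |4αβ|(ρ² + ρ⁻²) = |k² −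
δ| for an integer k. `exists_nonresonant_annulus` finds an annulus missing all of them.

The solution is a power series. The resolvents (k − L)⁻¹ are O(1/k), so by `norm_frobeniusCoeff_le`
the series converges on every disc about 0 where the coefficients are holomorphic, locally uniformly
in λ. To reach every point of a general simply connected domain, `exists_gauge` works in a
uniformizing coordinate, on the disc or the plane; this is where the Riemann mapping theorem is
needed.

The determinant of P is constant by Liouville's formula, and P is fixed by σ because its twist
solves the same initial value problem.

P is holomorphic in λ on an open annulus around C_r, so its Laurent coefficients, scaled by r^n,
decay geometrically. This beats every admissible weight (`exists_coeffs_of_differentiableOn`), so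
one r and one P serve all the Banach algebras.

Uniqueness of the frame is uniqueness for a linear equation on the logarithmic cover, which is
connected by `isPreconnected_logCover`. -/

lemma not_eventually_const_of_injOn {U : Set ℂ} (hU : IsOpen U) {f : ℂ → ℂ} (hi : InjOn f U)
    {z : ℂ} (hz : z ∈ U) : ¬ ∀ᶠ x in 𝓝 z, f x = f z := by
  intro h
  have h1 : ∀ᶠ x in 𝓝[≠] z, f x = f z ∧ x ∈ U ∧ x ≠ z := by
    filter_upwards [nhdsWithin_le_nhds h, nhdsWithin_le_nhds (hU.mem_nhds hz),
      self_mem_nhdsWithin] with x hx hxU hxz using ⟨hx, hxU, hxz⟩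
  obtain ⟨x, hx, hxU, hxz⟩ := h1.exists
  exact hxz (hi hxU hz hx)

lemma nhds_le_map_of_injOn {U : Set ℂ} (hU : IsOpen U) {f : ℂ → ℂ}
    (hf : DifferentiableOn ℂ f U) (hi : InjOn f U) {z : ℂ} (hz : z ∈ U) :
    𝓝 (f z) ≤ map f (𝓝 z) :=
  ((hf.analyticAt (hU.mem_nhds hz)).eventually_constant_or_nhds_le_map_nhds).resolve_left
    (not_eventually_const_of_injOn hU hi hz)

lemma isOpen_image_of_injOn {U : Set ℂ} (hU : IsOpen U) {f : ℂ → ℂ}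
    (hf : DifferentiableOn ℂ f U) (hi : InjOn f U) : IsOpen (f '' U) := by
  rw [isOpen_iff_mem_nhds]
  rintro _ ⟨z, hz, rfl⟩
  exact nhds_le_map_of_injOn hU hf hi hz (image_mem_map (hU.mem_nhds hz))

lemma eventually_deriv_ne_zero_of_injOn {U : Set ℂ} (hU : IsOpen U) {f : ℂ → ℂ}
    (hf : DifferentiableOn ℂ f U) (hi : InjOn f U) {z : ℂ} (hz : z ∈ U) :
    ∀ᶠ x in 𝓝[≠] z, deriv f x ≠ 0 := by
  have han : AnalyticAt ℂ (deriv f) z := (hf.deriv hU).analyticAt (hU.mem_nhds hz)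
  refine han.eventually_eq_zero_or_eventually_ne_zero.resolve_left fun h => ?_
  obtain ⟨ε, hε, hb⟩ := Metric.eventually_nhds_iff_ball.1 (h.and (hU.mem_nhds hz))
  refine not_eventually_const_of_injOn hU hi hz ?_
  filter_upwards [Metric.ball_mem_nhds z hε] with x hx
  exact Metric.isOpen_ball.is_const_of_deriv_eq_zero (convex_ball z ε).isPreconnected
    (hf.mono fun y hy => (hb y hy).2) (fun y hy => (hb y hy).1) hx (Metric.mem_ball_self hε)

/-- Open mapping makes the inverse continuous. It is differentiable at images of points with f' ≠ 0;
the remaining points are isolated, so their images are removable singularities. -/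
theorem exists_holomorphic_inverse {U : Set ℂ} (hU : IsOpen U) {f : ℂ → ℂ}
    (hf : DifferentiableOn ℂ f U) (hi : InjOn f U) :
    ∃ g : ℂ → ℂ, DifferentiableOn ℂ g (f '' U) ∧ ∀ z ∈ U, g (f z) = z := by
  have hg : ∀ z ∈ U, Function.invFunOn f U (f z) = z := fun z hz => hi.leftInvOn_invFunOn hz
  set g := Function.invFunOn f U
  have hcont : ∀ z ∈ U, ContinuousAt g (f z) := by
    intro z hz
    rw [ContinuousAt, hg z hz, tendsto_def]
    intro N hN
    refine mem_of_superset (nhds_le_map_of_injOn hU hf hi hz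
      (image_mem_map (inter_mem hN (hU.mem_nhds hz)))) ?_
    rintro _ ⟨x, ⟨hxN, hxU⟩, rfl⟩
    simpa [hg x hxU] using hxN
  have hopen := isOpen_image_of_injOn hU hf hi
  have hreg : ∀ z ∈ U, deriv f z ≠ 0 → DifferentiableAt ℂ g (f z) := by
    intro z hz hd
    refine (HasDerivAt.of_local_left_inverse (f := f) (f' := deriv f z) (hcont z hz) ?_ hd
      ?_).differentiableAt
    · rw [hg z hz]; exact (hf.differentiableAt (hU.mem_nhds hz)).hasDerivAt
    · filter_upwards [hopen.mem_nhds (mem_image_of_mem f hz)]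
      rintro _ ⟨x, hx, rfl⟩
      rw [hg x hx]
  refine ⟨g, ?_, hg⟩
  rintro _ ⟨z, hz, rfl⟩
  obtain ⟨N, hN, hNd⟩ := (mem_nhdsWithin_iff_exists_mem_nhds_inter.1
    (eventually_deriv_ne_zero_of_injOn hU hf hi hz))
  have hM : f '' (N ∩ U) ∈ 𝓝 (f z) := nhds_le_map_of_injOn hU hf hi hz
    (image_mem_map (inter_mem hN (hU.mem_nhds hz)))
  have key := (Complex.differentiableOn_compl_singleton_and_continuousAt_iff hM).1
    ⟨?_, hcont z hz⟩
  · exact (key.differentiableAt hM).differentiableWithinAt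
  · rintro _ ⟨⟨x, ⟨hxN, hxU⟩, rfl⟩, hx⟩
    exact (hreg x hxU (hNd ⟨hxN, fun h => hx (by rw [h]; rfl)⟩)).differentiableWithinAt

lemma deriv_ne_zero_of_injOn {U : Set ℂ} (hU : IsOpen U) {f : ℂ → ℂ}
    (hf : DifferentiableOn ℂ f U) (hi : InjOn f U) {z : ℂ} (hz : z ∈ U) : deriv f z ≠ 0 := by
  obtain ⟨g, hg, hgf⟩ := exists_holomorphic_inverse hU hf hi
  have h1 := (hg.differentiableAt ((isOpen_image_of_injOn hU hf hi).mem_nhds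
    (mem_image_of_mem f hz))).hasDerivAt
  have h2 := (hf.differentiableAt (hU.mem_nhds hz)).hasDerivAt
  have h3 : HasDerivAt (fun x => x) (deriv g (f z) * deriv f z) z := by
    refine (h1.comp z h2).congr_of_eventuallyEq ?_
    filter_upwards [hU.mem_nhds hz] with x hx using (hgf x hx).symm
  have h4 := h3.unique (hasDerivAt_id z)
  intro h
  simp [h] at h4

/-- **Hurwitz's theorem** for injective functions. -/
theorem injOn_of_tendstoLocallyUniformlyOn {ι : Type*} {p : Filter ι} [p.NeBot] {U : Set ℂ}
    (hU : IsOpen U) (hUc : IsPreconnected U) {F : ι → ℂ → ℂ} {f : ℂ → ℂ}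
    (hF : ∀ n, DifferentiableOn ℂ (F n) U) (hi : ∀ n, InjOn (F n) U)
    (hlim : TendstoLocallyUniformlyOn F f p U) {z₀ : ℂ} (hz₀ : z₀ ∈ U) (hd : deriv f z₀ ≠ 0) :
    InjOn f U := by
  have hf : DifferentiableOn ℂ f U := hlim.differentiableOn (Eventually.of_forall hF) hU
  intro a ha b hb hab
  by_contra hne
  have hnz : ∀ᶠ x in 𝓝[≠] b, f x - f a ≠ 0 := by
    have han : AnalyticAt ℂ (fun x => f x - f a) b :=
      (hf.sub_const (f a)).analyticAt (hU.mem_nhds hb)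
    refine han.eventually_eq_zero_or_eventually_ne_zero.resolve_left fun h => hd ?_
    have hEq : EqOn (fun x => f x - f a) (fun _ => 0) U :=
      AnalyticOnNhd.eqOn_of_preconnected_of_eventuallyEq
        (fun x hx => (hf.sub_const (f a)).analyticAt (hU.mem_nhds hx))
        (fun x _ => analyticAt_const) hUc hb h
    have : f =ᶠ[𝓝 z₀] fun _ => f a := by
      filter_upwards [hU.mem_nhds hz₀] with x hx
      simpa [sub_eq_zero] using hEq hx
    rw [this.deriv_eq]; simp
  have hev : ∀ᶠ x in 𝓝 b, x ∈ U ∧ x ≠ a ∧ (x ≠ b → f x - f a ≠ 0) := by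
    filter_upwards [hU.mem_nhds hb, isOpen_ne.mem_nhds (Ne.symm hne),
      eventually_nhdsWithin_iff.1 hnz] with x h1 h2 h3 using ⟨h1, h2, h3⟩
  obtain ⟨ε, hε, hball⟩ := Metric.nhds_basis_closedBall.eventually_iff.1 hev
  have hsubU : Metric.closedBall b ε ⊆ U := fun x hx => (hball hx).1
  obtain ⟨x₀, hx₀, hmin⟩ := (isCompact_sphere b ε).exists_isMinOn
    (NormedSpace.sphere_nonempty.2 hε.le)
    ((hf.continuousOn.mono (Metric.sphere_subset_closedBall.trans hsubU)).sub
      continuousOn_const).norm (f := fun x => ‖f x - f a‖)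
  set δ := ‖f x₀ - f a‖ with hδ
  have hδ0 : 0 < δ := norm_pos_iff.2 ((hball (Metric.sphere_subset_closedBall hx₀)).2.2
    (by rintro rfl; simp at hx₀; exact hε.ne hx₀))
  have hu := (tendstoLocallyUniformlyOn_iff_forall_isCompact hU).1 hlim _ hsubU
    (isCompact_closedBall b ε)
  have ha' := hlim.tendsto_at ha
  obtain ⟨n, hn1, hn2⟩ := ((Metric.tendstoUniformlyOn_iff.1 hu (δ / 4) (by positivity)).and
    (Metric.tendsto_nhds.1 ha' (δ / 4) (by positivity))).exists
  have hclose : ∀ x ∈ Metric.closedBall b ε, ‖(F n x - F n a) - (f x - f a)‖ < δ / 2 := by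
    intro x hx
    have h1 := hn1 x hx
    rw [dist_eq_norm] at h1 hn2
    have : (F n x - F n a) - (f x - f a) = -(f x - F n x) - (F n a - f a) := by ring
    rw [this]
    refine (norm_sub_le _ _).trans_lt ?_
    rw [norm_neg]; linarith
  have hne0 : ∀ x ∈ Metric.closedBall b ε, F n x - F n a ≠ 0 := fun x hx h =>
    (hball hx).2.1 (hi n (hsubU hx) ha (sub_eq_zero.1 h))
  -- Injectivity of `F n` removes zeros from this disc, so the maximum principle applies to the
  -- reciprocal. It is at most 2/δ on the circle, hence at b, whereas f a = f b forces ‖F n b − F n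
  -- a‖ < δ/2.
  have hdc : DiffContOnCl ℂ (fun x => (F n x - F n a)⁻¹) (Metric.ball b ε) := by
    apply DifferentiableOn.diffContOnCl
    rw [closure_ball _ hε.ne']
    exact (((hF n).mono hsubU).sub_const _).inv hne0
  have hbd := Complex.norm_le_of_forall_mem_frontier_norm_le Metric.isBounded_ball hdc
    (C := 2 / δ) (fun x hx => ?_) (z := b) (subset_closure (Metric.mem_ball_self hε))
  · have h1 := hclose b (Metric.mem_closedBall_self hε.le)
    rw [← hab, sub_self, sub_zero] at h1
    have h2 : 0 < ‖F n b - F n a‖ := norm_pos_iff.2 (hne0 b (Metric.mem_closedBall_self hε.le))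
    rw [norm_inv, inv_le_comm₀ h2 (by positivity), inv_div] at hbd
    linarith
  · rw [frontier_ball _ hε.ne'] at hx
    have h1 := hclose x (Metric.sphere_subset_closedBall hx)
    have h2 : δ ≤ ‖f x - f a‖ := hmin hx
    have h3 : ‖f x - f a‖ ≤ ‖F n x - F n a‖ + ‖(F n x - F n a) - (f x - f a)‖ := by
      have := norm_sub_le (F n x - F n a) ((F n x - F n a) - (f x - f a))
      simpa using this
    rw [norm_inv, inv_le_comm₀ (by linarith) (by positivity), inv_div]
    linarith

/-! ### The Riemann mapping theorem -/

/-- **Montel's theorem**, in the form of convergence along a free ultrafilter. -/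
theorem exists_tendstoLocallyUniformlyOn_of_bounded {U : Set ℂ} (hU : IsOpen U) {F : ℕ → ℂ → ℂ}
    (hF : ∀ n, DifferentiableOn ℂ (F n) U) (hb : ∀ n, ∀ z ∈ U, ‖F n z‖ ≤ 1) :
    ∃ (p : Filter ℕ) (f : ℂ → ℂ), p.NeBot ∧ p ≤ atTop ∧ TendstoLocallyUniformlyOn F f p U := by
  -- Along an ultrafilter every bounded sequence of values converges, so pointwise limits need no
  -- diagonal extraction. Cauchy's estimate then supplies a common local Lipschitz constant, which
  -- makes the convergence locally uniform.
  have hlim : ∀ z : ℂ, ∃ l : ℂ, z ∈ U → Tendsto (fun n => F n z) (hyperfilter ℕ : Filter ℕ) (𝓝 l) := by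
    intro z
    by_cases hz : z ∈ U
    · obtain ⟨l, -, hl⟩ := (isCompact_closedBall (0 : ℂ) 1).ultrafilter_le_nhds
        ((hyperfilter ℕ).map fun n => F n z) (by
          rw [le_principal_iff]
          change ∀ᶠ n in (hyperfilter ℕ : Filter ℕ), F n z ∈ Metric.closedBall (0 : ℂ) 1
          exact Eventually.of_forall fun n => by simpa using hb n z hz)
      exact ⟨l, fun _ => hl⟩
    · exact ⟨0, fun h => absurd h hz⟩
  choose f hf using hlim
  refine ⟨(hyperfilter ℕ : Filter ℕ), f, inferInstance,
    hyperfilter_le_cofinite.trans_eq Nat.cofinite_eq_atTop, ?_⟩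
  rw [Metric.tendstoLocallyUniformlyOn_iff]
  intro ε hε z hz
  obtain ⟨R, hR, hRU⟩ := Metric.nhds_basis_closedBall.mem_iff.1 (hU.mem_nhds hz)
  set ρ := R / 2 with hρ
  have hρ0 : 0 < ρ := by positivity
  have hsub : ∀ x ∈ Metric.ball z ρ, Metric.closedBall x ρ ⊆ U := fun x hx =>
    (Metric.closedBall_subset_closedBall' (by rw [Metric.mem_ball] at hx; linarith)).trans hRU
  have hlip : ∀ n, ∀ y ∈ Metric.ball z ρ, ‖F n y - F n z‖ ≤ 1 / ρ * ‖y - z‖ := by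
    intro n y hy
    refine (convex_ball z ρ).norm_image_sub_le_of_norm_deriv_le (𝕜 := ℂ) (fun x hx => ?_)
      (fun x hx => ?_) (Metric.mem_ball_self hρ0) hy
    · exact (hF n).differentiableAt (hU.mem_nhds (hsub x hx (Metric.mem_closedBall_self hρ0.le)))
    · refine Complex.norm_deriv_le_of_forall_mem_sphere_norm_le hρ0 ?_ fun w hw =>
        hb n w (hsub x hx (Metric.sphere_subset_closedBall hw))
      apply DifferentiableOn.diffContOnCl
      rw [closure_ball _ hρ0.ne']
      exact (hF n).mono (hsub x hx)
  have hlipf : ∀ y ∈ Metric.ball z ρ, ‖f y - f z‖ ≤ 1 / ρ * ‖y - z‖ := by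
    intro y hy
    have hyU := hsub y hy (Metric.mem_closedBall_self hρ0.le)
    exact le_of_tendsto ((hf y hyU).sub (hf z hz)).norm (Eventually.of_forall fun n => hlip n y hy)
  refine ⟨Metric.ball z (min ρ (ε * ρ / 3)), mem_nhdsWithin_of_mem_nhds
    (Metric.ball_mem_nhds _ (by positivity)), ?_⟩
  filter_upwards [Metric.tendsto_nhds.1 (hf z hz) (ε / 3) (by positivity)] with n hn y hy
  rw [Metric.mem_ball, lt_min_iff, dist_eq_norm] at hy
  have hyρ : y ∈ Metric.ball z ρ := by rw [Metric.mem_ball, dist_eq_norm]; exact hy.1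
  have h0 : 1 / ρ * ‖y - z‖ < ε / 3 := by
    rw [one_div, inv_mul_lt_iff₀ hρ0]; linarith [hy.2]
  have h1 := hlip n y hyρ
  have h2 := hlipf y hyρ
  rw [dist_eq_norm] at hn ⊢
  have : f y - F n y = (f y - f z) - (F n z - f z) - (F n y - F n z) := by ring
  rw [this]
  refine (norm_sub_le _ _).trans_lt ?_
  have := norm_sub_le (f y - f z) (F n z - f z)
  linarith

/-- The disc automorphism `z ↦ (z - a) / (1 - ā z)`. -/
noncomputable def mobius (a z : ℂ) : ℂ := (z - a) / (1 - star a * z)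

lemma one_sub_star_mul_ne_zero {a z : ℂ} (ha : ‖a‖ < 1) (hz : ‖z‖ < 1) : 1 - star a * z ≠ 0 := by
  intro h
  have h1 : ‖star a * z‖ = 1 := by rw [← sub_eq_zero.1 h]; simp
  rw [norm_mul, norm_star] at h1
  nlinarith [norm_nonneg a, norm_nonneg z]

lemma norm_mobius_lt_one {a z : ℂ} (ha : ‖a‖ < 1) (hz : ‖z‖ < 1) : ‖mobius a z‖ < 1 := by
  rw [mobius, norm_div, div_lt_one (norm_pos_iff.2 (one_sub_star_mul_ne_zero ha hz))]
  refine lt_of_pow_lt_pow_left₀ 2 (norm_nonneg _) ?_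
  have ha' : ‖a‖ ^ 2 < 1 := by nlinarith [norm_nonneg a]
  have hz' : ‖z‖ ^ 2 < 1 := by nlinarith [norm_nonneg z]
  have key : ‖1 - star a * z‖ ^ 2 - ‖z - a‖ ^ 2 = (1 - ‖a‖ ^ 2) * (1 - ‖z‖ ^ 2) := by
    simp only [Complex.sq_norm, Complex.normSq_apply]
    simp
    ring
  nlinarith

lemma mobius_mobius {a z : ℂ} (ha : ‖a‖ < 1) (hz : ‖z‖ < 1) : mobius (-a) (mobius a z) = z := by
  have h1 := one_sub_star_mul_ne_zero ha hz
  have h2 := one_sub_star_mul_ne_zero (a := -a) (by simpa using ha) (norm_mobius_lt_one ha hz)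
  have h3 := one_sub_star_mul_ne_zero ha ha
  rw [mobius, div_eq_iff h2, mobius]
  rw [star_neg]
  linear_combination div_mul_cancel₀ (z - a) h1

lemma mobius_injOn {a : ℂ} (ha : ‖a‖ < 1) : InjOn (mobius a) (Metric.ball 0 1) := by
  intro x hx y hy h
  rw [mem_ball_zero_iff] at hx hy
  rw [← mobius_mobius ha hx, h, mobius_mobius ha hy]

lemma hasDerivAt_mobius {a z : ℂ} (ha : ‖a‖ < 1) (hz : ‖z‖ < 1) :
    HasDerivAt (mobius a) ((1 - star a * a) / (1 - star a * z) ^ 2) z := by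
  have h1 := one_sub_star_mul_ne_zero ha hz
  have h2 := ((hasDerivAt_id z).sub_const a).div
    (((hasDerivAt_id z).const_mul (star a)).const_sub 1) h1
  convert! h2 using 1
  simp
  ring

lemma mobius_self (a : ℂ) : mobius a a = 0 := by simp [mobius]

lemma mobius_zero (a : ℂ) : mobius a 0 = -a := by simp [mobius]

/-- Holomorphic square roots on simply connected domains. -/
lemma exists_holomorphic_sqrt {U : Set ℂ} (hU : IsOpen U) (hUs : IsSimplyConnected U)
    {f : ℂ → ℂ} (hf : DifferentiableOn ℂ f U) (h0 : ∀ z ∈ U, f z ≠ 0) :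
    ∃ q : ℂ → ℂ, DifferentiableOn ℂ q U ∧ ∀ z, q z ^ 2 = f z := by
  obtain ⟨q, hqc, hq⟩ := Complex.exists_continuousOn_pow_eq hUs hU hf.continuousOn
    (by rintro ⟨z, hz, h⟩; exact h0 z hz h) two_ne_zero
  refine ⟨q, fun z hz => ?_, hq⟩
  have hqz : q z ≠ 0 := fun h => h0 z hz (by rw [← hq, h]; simp)
  have hqca := hqc.continuousAt (hU.mem_nhds hz)
  have hfd := (hf.differentiableAt (hU.mem_nhds hz)).hasDerivAt
  -- Since q² = f, the slope of q is the slope of f divided by q w + q z. Continuity of q alone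
  -- therefore gives the derivative.
  suffices h : HasDerivAt q (deriv f z / (q z + q z)) z from
    h.differentiableAt.differentiableWithinAt
  rw [hasDerivAt_iff_tendsto_slope] at hfd ⊢
  have hs : Tendsto (fun w => q w + q z) (𝓝[≠] z) (𝓝 (q z + q z)) :=
    (hqca.tendsto.mono_left nhdsWithin_le_nhds).add_const _
  have hne : q z + q z ≠ 0 := by rw [← two_mul]; simpa using hqz
  refine (hfd.div hs hne).congr' ?_
  filter_upwards [hs.eventually_ne hne] with w hw
  change slope f z w / (q w + q z) = slope q z w
  rw [slope_def_field, slope_def_field, ← hq w, ← hq z, div_div, mul_comm (w - z), ← div_div]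
  congr 1
  field_simp
  ring

/-- Injective holomorphic maps of `U` to the unit disc that map `0` to `0`. -/
structure IsDiscEmbedding (U : Set ℂ) (f : ℂ → ℂ) : Prop where
  diff : DifferentiableOn ℂ f U
  inj : InjOn f U
  maps : ∀ z ∈ U, ‖f z‖ < 1
  zero : f 0 = 0

lemma exists_discEmbedding_of_bounded {U : Set ℂ} (h0 : (0 : ℂ) ∈ U) {f : ℂ → ℂ}
    (hf : DifferentiableOn ℂ f U) (hi : InjOn f U) (hb : ∀ z ∈ U, ‖f z‖ < 1) :
    IsDiscEmbedding U (fun z => mobius (f 0) (f z)) where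
  diff := fun z hz => ((hasDerivAt_mobius (hb 0 h0) (hb z hz)).differentiableAt).comp_differentiableWithinAt
    z (hf z hz)
  inj := (mobius_injOn (hb 0 h0)).comp hi fun z hz => by simpa using hb z hz
  maps := fun z hz => norm_mobius_lt_one (hb 0 h0) (hb z hz)
  zero := mobius_self _

/-- For a outside U, a square root q of z − a is injective and never takes both a value and its
negative. Its image contains a disc about q 0, so it misses the opposite disc about −q 0, and
inversion at −q 0 makes it bounded. -/
lemma exists_discEmbedding {U : Set ℂ} (hU : IsOpen U) (hUs : IsSimplyConnected U)
    (hne : U ≠ univ) (h0 : (0 : ℂ) ∈ U) : ∃ f, IsDiscEmbedding U f := by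
  obtain ⟨a, ha⟩ := (ne_univ_iff_exists_notMem U).1 hne
  have hza : ∀ z ∈ U, z - a ≠ 0 := fun z hz h => ha (by rwa [← sub_eq_zero.1 h])
  obtain ⟨q, hq, hq2⟩ := exists_holomorphic_sqrt hU hUs
    ((differentiable_id.sub_const a).differentiableOn (s := U)) hza
  have hqi : InjOn q U := fun x _ y _ h => by
    have := hq2 x
    rw [h, hq2 y] at this
    simpa using this.symm
  have hq0 : ∀ z ∈ U, q z ≠ 0 := fun z hz h => hza z hz (by have := hq2 z; simp [h] at this; simpa using this.symm)
  obtain ⟨ε, hε, hεq⟩ := Metric.nhds_basis_ball.mem_iff.1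
    ((isOpen_image_of_injOn hU hq hqi).mem_nhds (mem_image_of_mem q h0))
  have hfar : ∀ z ∈ U, ε ≤ ‖q z + q 0‖ := by
    intro z hz
    by_contra! h
    have h1 : -q z ∈ Metric.ball (q 0) ε := by
      rw [Metric.mem_ball, dist_eq_norm, ← norm_neg]
      convert! h using 2; ring
    obtain ⟨x, hx, hxz⟩ := hεq h1
    have : x = z := by
      have h2 := hq2 x
      rw [hxz, neg_sq, hq2 z] at h2
      simpa using h2.symm
    subst this
    exact hq0 x hx (self_eq_neg.1 hxz)
  have hne0 : ∀ z ∈ U, q z + q 0 ≠ 0 := fun z hz h => by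
    have := hfar z hz
    rw [h, norm_zero] at this
    exact absurd this (not_le.2 hε)
  refine ⟨_, exists_discEmbedding_of_bounded (f := fun z => (ε / 2 : ℝ) / (q z + q 0)) h0 ?_ ?_ ?_⟩
  · exact (differentiableOn_const _).div (hq.add_const _) hne0
  · intro x hx y hy h
    have hε' : ((ε / 2 : ℝ) : ℂ) ≠ 0 := by exact_mod_cast (half_pos hε).ne'
    simp only [div_eq_mul_inv] at h
    have := inv_injective (mul_left_cancel₀ (by simpa [div_eq_mul_inv] using hε') h)
    exact hqi hx hy (add_right_cancel this)
  · intro z hz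
    rw [norm_div, Complex.norm_real, Real.norm_of_nonneg (by positivity),
      div_lt_one (norm_pos_iff.2 (hne0 z hz))]
    linarith [hfar z hz]

/-- The Koebe square root trick: a non-surjective embedding into the disc is not extremal. -/
lemma exists_norm_deriv_lt {U : Set ℂ} (hU : IsOpen U) (hUs : IsSimplyConnected U)
    (h0 : (0 : ℂ) ∈ U) {f : ℂ → ℂ} (hf : IsDiscEmbedding U f) {c : ℂ} (hc : ‖c‖ < 1)
    (hcU : ∀ z ∈ U, f z ≠ c) : ∃ g, IsDiscEmbedding U g ∧ ‖deriv f 0‖ < ‖deriv g 0‖ := by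
  have hh : DifferentiableOn ℂ (fun z => mobius c (f z)) U := fun z hz =>
    (hasDerivAt_mobius hc (hf.maps z hz)).differentiableAt.comp_differentiableWithinAt z
      (hf.diff z hz)
  have hh0 : ∀ z ∈ U, mobius c (f z) ≠ 0 := fun z hz h => hcU z hz (by
    rw [mobius, div_eq_zero_iff] at h
    exact sub_eq_zero.1 (h.resolve_right (one_sub_star_mul_ne_zero hc (hf.maps z hz))))
  obtain ⟨q, hq, hq2⟩ := exists_holomorphic_sqrt hU hUs hh hh0
  have hqi : InjOn q U := fun x hx y hy h => hf.inj hx hy (mobius_injOn hc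
    (by simpa using hf.maps x hx) (by simpa using hf.maps y hy) (by rw [← hq2, ← hq2, h]))
  have hqb : ∀ z ∈ U, ‖q z‖ < 1 := fun z hz => by
    have := norm_mobius_lt_one hc (hf.maps z hz)
    rw [← hq2, norm_pow] at this
    exact (pow_lt_one_iff_of_nonneg (norm_nonneg _) two_ne_zero).1 this
  have hG := exists_discEmbedding_of_bounded h0 hq hqi hqb
  refine ⟨_, hG, ?_⟩
  set b := q 0 with hb
  have hb1 : ‖b‖ < 1 := hqb 0 h0
  have hbc : b ^ 2 = -c := by rw [hb, hq2, hf.zero, mobius_zero]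
  have hb0 : b ≠ 0 := fun h => hh0 0 h0 (by rw [← hq2, ← hb, h]; simp)
  have hqd := (hq.differentiableAt (hU.mem_nhds h0)).hasDerivAt
  have hfd := (hf.diff.differentiableAt (hU.mem_nhds h0)).hasDerivAt
  have e1 : HasDerivAt (fun z => q z ^ 2) (2 * b * deriv q 0) 0 := by
    simpa using! hqd.pow 2
  have e2 : HasDerivAt (fun z => q z ^ 2) ((1 - star c * c) * deriv f 0) 0 := by
    simp only [hq2]
    have := (hasDerivAt_mobius hc (hf.maps 0 h0)).comp 0 hfd
    simpa [hf.zero] using! this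
  have e3 := e1.unique e2
  have e4 : deriv (fun z => mobius b (q z)) 0 = (1 - star b * b)⁻¹ * deriv q 0 := by
    have := ((hasDerivAt_mobius hb1 hb1).comp 0 hqd).deriv
    have h1 := one_sub_star_mul_ne_zero hb1 hb1
    rw [show (fun z => mobius b (q z)) = mobius b ∘ q from rfl, this]
    field_simp
  have hnb : ∀ x : ℂ, star x * x = ((‖x‖ ^ 2 : ℝ) : ℂ) := fun x => by
    have := Complex.conj_mul' x
    simpa using this
  have hcn : ‖c‖ = ‖b‖ ^ 2 := by rw [← norm_neg c, ← hbc, norm_pow]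
  have n1 : 2 * ‖b‖ * ‖deriv q 0‖ = (1 - ‖c‖ ^ 2) * ‖deriv f 0‖ := by
    have := congrArg norm e3
    rw [hnb, ← Complex.ofReal_one, ← Complex.ofReal_sub, norm_mul, norm_mul, norm_mul,
      Complex.norm_real, Real.norm_of_nonneg (by nlinarith [norm_nonneg c])] at this
    simpa using this
  have hbpos : 0 < ‖b‖ := norm_pos_iff.2 hb0
  have n2 : ‖deriv (fun z => mobius b (q z)) 0‖ = (1 - ‖b‖ ^ 2)⁻¹ * ‖deriv q 0‖ := by
    rw [e4, hnb, ← Complex.ofReal_one, ← Complex.ofReal_sub, norm_mul, norm_inv,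
      Complex.norm_real, Real.norm_of_nonneg (by nlinarith)]
  have hpos : 0 < 1 - ‖b‖ ^ 2 := by nlinarith
  have hfpos : 0 < ‖deriv f 0‖ := norm_pos_iff.2 (deriv_ne_zero_of_injOn hU hf.diff hf.inj h0)
  rw [n2, lt_inv_mul_iff₀ hpos]
  rw [hcn] at n1
  -- The new derivative is (1 + ‖b‖²)/(2‖b‖) times the old one in norm; the gain is exactly (1 −
  -- ‖b‖)² > 0.
  have h5 : 2 * ‖b‖ * ‖deriv q 0‖ = (1 - ‖b‖ ^ 2) * ((1 + ‖b‖ ^ 2) * ‖deriv f 0‖) := by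
    rw [n1]; ring
  have h6 : 0 < (1 - ‖b‖ ^ 2) * ‖deriv f 0‖ * (1 - ‖b‖) ^ 2 := by
    have : 0 < 1 - ‖b‖ := by linarith
    positivity
  nlinarith

/-- The **Riemann mapping theorem**. -/
theorem exists_discEmbedding_surjective {U : Set ℂ} (hU : IsOpen U) (hUs : IsSimplyConnected U)
    (hne : U ≠ univ) (h0 : (0 : ℂ) ∈ U) :
    ∃ f, IsDiscEmbedding U f ∧ f '' U = Metric.ball 0 1 := by
  obtain ⟨f₀, hf₀⟩ := exists_discEmbedding hU hUs hne h0
  set D : Set ℝ := {d | ∃ f, IsDiscEmbedding U f ∧ d = ‖deriv f 0‖} with hD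
  have hDne : D.Nonempty := ⟨_, f₀, hf₀, rfl⟩
  obtain ⟨ρ, hρ, hρU⟩ := Metric.nhds_basis_closedBall.mem_iff.1 (hU.mem_nhds h0)
  have hDb : BddAbove D := by
    refine ⟨1 / ρ, ?_⟩
    rintro _ ⟨f, hf, rfl⟩
    refine Complex.norm_deriv_le_of_forall_mem_sphere_norm_le hρ ?_ fun w hw =>
      (hf.maps w (hρU (Metric.sphere_subset_closedBall hw))).le
    apply DifferentiableOn.diffContOnCl
    rw [closure_ball _ hρ.ne']
    exact hf.diff.mono hρU
  obtain ⟨d, -, hd, hdD⟩ := exists_seq_tendsto_sSup hDne hDb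
  choose F hF hFd using hdD
  obtain ⟨p, f, hp, hpt, hlim⟩ := exists_tendstoLocallyUniformlyOn_of_bounded hU
    (fun n => (hF n).diff) (fun n z hz => ((hF n).maps z hz).le)
  have hf : DifferentiableOn ℂ f U :=
    hlim.differentiableOn (Eventually.of_forall fun n => (hF n).diff) hU
  have hder : ‖deriv f 0‖ = sSup D := by
    have h1 := ((hlim.deriv (Eventually.of_forall fun n => (hF n).diff) hU).tendsto_at h0).norm
    refine tendsto_nhds_unique h1 ((hd.mono_left hpt).congr fun n => ?_)
    exact hFd n
  -- Positivity makes the derivative of the limit nonzero at 0, which is the nonconstancy needed for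
  -- Hurwitz's theorem.
  have hpos : 0 < sSup D := lt_of_lt_of_le
    (norm_pos_iff.2 (deriv_ne_zero_of_injOn hU hf₀.diff hf₀.inj h0)) (le_csSup hDb ⟨f₀, hf₀, rfl⟩)
  have hinj : InjOn f U := injOn_of_tendstoLocallyUniformlyOn hU
    hUs.isPathConnected.isConnected.isPreconnected (fun n => (hF n).diff) (fun n => (hF n).inj)
    hlim h0 (norm_pos_iff.1 (hder ▸ hpos))
  have hle : ∀ z ∈ U, ‖f z‖ ≤ 1 := fun z hz =>
    le_of_tendsto (hlim.tendsto_at hz).norm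
      (Eventually.of_forall fun n => ((hF n).maps z hz).le)
  have hemb : IsDiscEmbedding U f := by
    refine ⟨hf, hinj, fun z hz => ?_, ?_⟩
    -- The limit is known only to satisfy ‖f‖ ≤ 1; openness of its image makes the inequality
    -- strict.
    · have h1 : f '' U ⊆ interior (Metric.closedBall 0 1) :=
        interior_maximal (by rintro _ ⟨x, hx, rfl⟩; simpa using hle x hx)
          (isOpen_image_of_injOn hU hf hinj)
      rw [interior_closedBall _ one_ne_zero] at h1
      simpa using h1 (mem_image_of_mem f hz)
    · refine tendsto_nhds_unique (hlim.tendsto_at h0) ?_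
      simp only [(hF _).zero]
      exact tendsto_const_nhds
  refine ⟨f, hemb, Subset.antisymm ?_ ?_⟩
  · rintro _ ⟨x, hx, rfl⟩
    simpa using hemb.maps x hx
  · intro c hc
    by_contra hcU
    obtain ⟨g, hg, hlt⟩ := exists_norm_deriv_lt hU hUs h0 hemb (by simpa using hc)
      (fun z hz h => hcU ⟨z, hz, h⟩)
    exact absurd (le_csSup hDb ⟨g, hg, rfl⟩) (not_le.2 (hder ▸ hlt))

/-- A simply connected domain is biholomorphic to the unit disc or to the plane. -/
theorem exists_uniformization {U : Set ℂ} (hU : IsOpen U) (hUs : IsSimplyConnected U)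
    (h0 : (0 : ℂ) ∈ U) :
    ∃ (V : Set ℂ) (φ ψ : ℂ → ℂ), (V = univ ∨ V = Metric.ball 0 1) ∧
      DifferentiableOn ℂ φ V ∧ DifferentiableOn ℂ ψ U ∧ MapsTo φ V U ∧ MapsTo ψ U V ∧
      (∀ z ∈ U, φ (ψ z) = z) ∧ (∀ ζ ∈ V, ψ (φ ζ) = ζ) ∧ φ 0 = 0 ∧ ψ 0 = 0 := by
  by_cases hne : U = univ
  · subst hne
    exact ⟨univ, id, id, Or.inl rfl, differentiableOn_id, differentiableOn_id, mapsTo_id _,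
      mapsTo_id _, fun _ _ => rfl, fun _ _ => rfl, rfl, rfl⟩
  · obtain ⟨ψ, hψ, him⟩ := exists_discEmbedding_surjective hU hUs hne h0
    obtain ⟨φ, hφ, hφψ⟩ := exists_holomorphic_inverse hU hψ.diff hψ.inj
    rw [him] at hφ
    have hpre : ∀ ζ ∈ Metric.ball (0 : ℂ) 1, ∃ z ∈ U, ψ z = ζ := fun ζ hζ => by
      rw [← him] at hζ; exact hζ
    refine ⟨Metric.ball 0 1, φ, ψ, Or.inr rfl, hφ, hψ.diff, ?_, ?_, hφψ, ?_, ?_, hψ.zero⟩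
    · intro ζ hζ
      obtain ⟨z, hz, rfl⟩ := hpre ζ hζ
      rwa [hφψ z hz]
    · intro z hz
      simpa using hψ.maps z hz
    · intro ζ hζ
      obtain ⟨z, hz, rfl⟩ := hpre ζ hζ
      rw [hφψ z hz]
    · simpa [hψ.zero] using hφψ 0 h0

/-! ### Integrals of holomorphic families -/

/-- Cauchy's estimate dominates the z-derivative using only joint continuity of F. Measurability of
that derivative in t comes from writing it as a limit of continuous difference quotients. -/
lemma differentiableOn_intervalIntegral {E : Type*} [NormedAddCommGroup E] [NormedSpace ℂ E]
    [CompleteSpace E] {V : Set ℂ} (hV : IsOpen V) {a b : ℝ} {F : ℂ → ℝ → E}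
    (hc : ContinuousOn (fun p : ℂ × ℝ => F p.1 p.2) (V ×ˢ univ))
    (hd : ∀ t, DifferentiableOn ℂ (fun z => F z t) V) :
    DifferentiableOn ℂ (fun z => ∫ t in a..b, F z t) V := by
  intro z₀ hz₀
  have hcz : ∀ z ∈ V, Continuous (F z) := fun z hz => by
    have : Continuous ((fun p : ℂ × ℝ => F p.1 p.2) ∘ fun t : ℝ => (z, t)) :=
      hc.comp_continuous (by fun_prop) fun t => ⟨hz, mem_univ t⟩
    exact this
  obtain ⟨R, hR, hRV⟩ := Metric.nhds_basis_closedBall.mem_iff.1 (hV.mem_nhds hz₀)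
  set ρ := R / 2 with hρ
  have hρ0 : 0 < ρ := by positivity
  have hsub : ∀ x ∈ Metric.ball z₀ ρ, Metric.closedBall x ρ ⊆ Metric.closedBall z₀ R := fun x hx =>
    Metric.closedBall_subset_closedBall' (by rw [Metric.mem_ball] at hx; linarith)
  obtain ⟨M, hM⟩ := ((isCompact_closedBall z₀ R).prod (isCompact_uIcc (a := a) (b := b))).exists_bound_of_continuousOn
    (hc.mono (prod_mono hRV (subset_univ _)))
  have hmem : ∀ x ∈ Metric.ball z₀ ρ, x ∈ V := fun x hx =>
    hRV (hsub x hx (Metric.mem_closedBall_self hρ0.le))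
  have hder : ∀ t, ∀ x ∈ Metric.ball z₀ ρ, HasDerivAt (fun z => F z t) (deriv (fun z => F z t) x) x :=
    fun t x hx => ((hd t).differentiableAt (hV.mem_nhds (hmem x hx))).hasDerivAt
  have hmeas : MeasureTheory.AEStronglyMeasurable (fun t => deriv (fun z => F z t) z₀)
      (MeasureTheory.volume.restrict (uIoc a b)) := by
    have hseq : Tendsto (fun n : ℕ => z₀ + ((ρ / (n + 2) : ℝ) : ℂ)) atTop (𝓝[≠] z₀) := by
      refine tendsto_nhdsWithin_iff.2 ⟨?_, Eventually.of_forall fun n => ?_⟩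
      · have h1 : Tendsto (fun n : ℕ => ρ / ((n : ℝ) + 2)) atTop (𝓝 0) :=
          tendsto_const_nhds.div_atTop
            (tendsto_atTop_add_const_right _ _ tendsto_natCast_atTop_atTop)
        have h2 := (Complex.continuous_ofReal.tendsto 0).comp h1
        simpa using! h2.const_add z₀
      · have : ((ρ / (n + 2) : ℝ) : ℂ) ≠ 0 := by
          have : (0 : ℝ) < ρ / (n + 2) := by positivity
          exact_mod_cast this.ne'
        simpa using this
    refine aestronglyMeasurable_of_tendsto_ae atTop
      (f := fun (n : ℕ) t => slope (fun z => F z t) z₀ (z₀ + ((ρ / (n + 2) : ℝ) : ℂ)))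
      (fun n => ?_) (Eventually.of_forall fun t => ?_)
    · have hn : z₀ + ((ρ / (n + 2) : ℝ) : ℂ) ∈ V := by
        apply hmem
        rw [Metric.mem_ball, dist_eq_norm, add_sub_cancel_left, Complex.norm_real,
          Real.norm_of_nonneg (by positivity), div_lt_iff₀ (by positivity)]
        nlinarith [(Nat.cast_nonneg n : (0 : ℝ) ≤ n)]
      simp only [slope_def_module]
      exact (((hcz _ hn).sub (hcz _ hz₀)).const_smul _).aestronglyMeasurable
    · exact (hasDerivAt_iff_tendsto_slope.1 (hder t z₀ (Metric.mem_ball_self hρ0))).comp hseq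
  have key := intervalIntegral.hasDerivAt_integral_of_dominated_loc_of_deriv_le
    (μ := MeasureTheory.volume) (a := a) (b := b) (F := F)
    (F' := fun z t => deriv (fun z => F z t) z) (bound := fun _ => M / ρ)
    (Metric.ball_mem_nhds z₀ hρ0)
    (by
      filter_upwards [hV.mem_nhds hz₀] with z hz using (hcz z hz).aestronglyMeasurable)
    ((hcz z₀ hz₀).intervalIntegrable _ _) hmeas
    (Eventually.of_forall fun t ht x hx => by
      refine Complex.norm_deriv_le_of_forall_mem_sphere_norm_le hρ0 ?_ fun w hw =>
        hM (w, t) ⟨hsub x hx (Metric.sphere_subset_closedBall hw), uIoc_subset_uIcc ht⟩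
      apply DifferentiableOn.diffContOnCl
      rw [closure_ball _ hρ0.ne']
      exact (hd t).mono ((hsub x hx).trans hRV))
    intervalIntegrable_const
    (Eventually.of_forall fun t _ x hx => hder t x hx)
  exact key.2.differentiableAt.differentiableWithinAt

lemma differentiableOn_circleIntegral {E : Type*} [NormedAddCommGroup E] [NormedSpace ℂ E]
    [CompleteSpace E] {V : Set ℂ} (hV : IsOpen V) {c : ℂ} {R : ℝ} (hR : 0 ≤ R) {f : ℂ → ℂ → E}
    (hc : ContinuousOn (fun p : ℂ × ℂ => f p.1 p.2) (V ×ˢ Metric.sphere c R))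
    (hd : ∀ w ∈ Metric.sphere c R, DifferentiableOn ℂ (fun z => f z w) V) :
    DifferentiableOn ℂ (fun z => ∮ w in C(c, R), f z w) V := by
  simp only [circleIntegral]
  refine differentiableOn_intervalIntegral hV ?_ fun t =>
    (hd _ (circleMap_mem_sphere c hR t)).const_smul _
  have h1 : Continuous fun p : ℂ × ℝ => deriv (circleMap c R) p.2 := by
    simp only [deriv_circleMap]
    fun_prop
  refine h1.continuousOn.smul ?_
  have : ContinuousOn ((fun p : ℂ × ℂ => f p.1 p.2) ∘ fun p : ℂ × ℝ => (p.1, circleMap c R p.2))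
      (V ×ˢ univ) :=
    hc.comp (by fun_prop) fun p hp => ⟨hp.1, circleMap_mem_sphere c hR p.2⟩
  exact this

/-! ### Laurent series and the Banach spaces `𝒜_r` -/

/-- The open annulus `r₁ < |w| < r₂`. -/
def annulus (r₁ r₂ : ℝ) : Set ℂ := {w | r₁ < ‖w‖ ∧ ‖w‖ < r₂}

lemma isOpen_annulus (r₁ r₂ : ℝ) : IsOpen (annulus r₁ r₂) :=
  (isOpen_lt continuous_const continuous_norm).inter (isOpen_lt continuous_norm continuous_const)

lemma ne_zero_of_mem_annulus {r₁ r₂ : ℝ} (h : 0 ≤ r₁) {w : ℂ} (hw : w ∈ annulus r₁ r₂) : w ≠ 0 :=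
  norm_pos_iff.1 (h.trans_lt hw.1)

lemma sphere_subset_annulus {r₁ r₂ ρ : ℝ} (h₁ : r₁ < ρ) (h₂ : ρ < r₂) :
    Metric.sphere 0 ρ ⊆ annulus r₁ r₂ := fun w hw => by
  rw [mem_sphere_zero_iff_norm] at hw
  exact ⟨hw ▸ h₁, hw ▸ h₂⟩

/-- The Laurent coefficients of a function, computed on the circle of radius `ρ`. -/
noncomputable def laurentCoeff (ρ : ℝ) (g : ℂ → ℂ) (n : ℤ) : ℂ :=
  (2 * Real.pi * Complex.I : ℂ)⁻¹ • ∮ w in C(0, ρ), w ^ (-n - 1) * g w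

/-- Moving the contour lets coefficients on C_r be estimated on a smaller and on a larger circle. -/
lemma laurentCoeff_eq {r₁ r₂ ρ ρ' : ℝ} (h0 : 0 ≤ r₁) (h₁ : r₁ < ρ) (h₂ : ρ ≤ ρ') (h₃ : ρ' < r₂)
    {g : ℂ → ℂ} (hg : DifferentiableOn ℂ g (annulus r₁ r₂)) (n : ℤ) :
    laurentCoeff ρ' g n = laurentCoeff ρ g n := by
  have hd : DifferentiableOn ℂ (fun w => w ^ (-n - 1) * g w) (annulus r₁ r₂) := fun w hw =>
    ((differentiableAt_zpow.2 (Or.inl (ne_zero_of_mem_annulus h0 hw))).differentiableWithinAt).mul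
      (hg w hw)
  have hsub : Metric.closedBall (0 : ℂ) ρ' \ Metric.ball 0 ρ ⊆ annulus r₁ r₂ := by
    rintro w ⟨hw1, hw2⟩
    simp only [mem_closedBall_zero_iff, mem_ball_zero_iff, not_lt] at hw1 hw2
    exact ⟨h₁.trans_le hw2, hw1.trans_lt h₃⟩
  rw [laurentCoeff, laurentCoeff,
    Complex.circleIntegral_eq_of_differentiable_on_annulus_off_countable (h0.trans_lt h₁) h₂
      countable_empty (hd.continuousOn.mono hsub) fun z hz => ?_]
  refine hd.differentiableAt ((isOpen_annulus r₁ r₂).mem_nhds (hsub ?_))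
  exact ⟨Metric.ball_subset_closedBall hz.1.1, fun h => hz.1.2 (Metric.ball_subset_closedBall h)⟩

lemma norm_laurentCoeff_le {ρ M : ℝ} (hρ : 0 < ρ) {g : ℂ → ℂ}
    (hM : ∀ w ∈ Metric.sphere (0 : ℂ) ρ, ‖g w‖ ≤ M) (n : ℤ) :
    ‖laurentCoeff ρ g n‖ ≤ M * ρ ^ (-n) := by
  refine (circleIntegral.norm_two_pi_i_inv_smul_integral_le_of_norm_le_const (C := ρ ^ (-n - 1) * M)
    hρ.le fun w hw => ?_).trans_eq ?_
  · rw [norm_mul, norm_zpow, mem_sphere_zero_iff_norm.1 hw]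
    exact mul_le_mul_of_nonneg_left (hM w hw) (by positivity)
  · rw [zpow_sub_one₀ hρ.ne']
    field_simp

/-- The products r^n a_n are the Fourier coefficients of θ ↦ g(r e^{iθ}), and a continuous function
with summable Fourier coefficients is the pointwise sum of its series. -/
lemma hasSum_laurentCoeff {r : ℝ} (hr : 0 < r) {g : ℂ → ℂ}
    (hg : ContinuousOn g (Metric.sphere 0 r))
    (hs : Summable fun n : ℤ => (r : ℂ) ^ n * laurentCoeff r g n) {w : ℂ} (hw : ‖w‖ = r) :
    HasSum (fun n : ℤ => laurentCoeff r g n * w ^ n) (g w) := by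
  have : Fact (0 < 2 * Real.pi) := ⟨Real.two_pi_pos⟩
  have hrc : (r : ℂ) ≠ 0 := by exact_mod_cast hr.ne'
  have hmem : ∀ x : AddCircle (2 * Real.pi), (r : ℂ) * (AddCircle.toCircle x : ℂ) ∈ Metric.sphere (0 : ℂ) r := by
    intro x
    rw [mem_sphere_zero_iff_norm, norm_mul, Circle.norm_coe, mul_one, Complex.norm_real,
      Real.norm_of_nonneg hr.le]
  let G : C(AddCircle (2 * Real.pi), ℂ) :=
    ⟨fun x => g ((r : ℂ) * (AddCircle.toCircle x : ℂ)),
      hg.comp_continuous (by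
        have := AddCircle.continuous_toCircle (T := 2 * Real.pi)
        fun_prop) hmem⟩
  have hpi : (Real.pi : ℂ) ≠ 0 := by exact_mod_cast Real.pi_ne_zero
  have hexp : ∀ θ : ℝ, (AddCircle.toCircle (θ : AddCircle (2 * Real.pi)) : ℂ) =
      Complex.exp (θ * Complex.I) := by
    intro θ
    rw [AddCircle.toCircle_apply_mk, Circle.coe_exp]
    congr 1
    push_cast
    field_simp
  have hcoef : ∀ n : ℤ, fourierCoeff G n = (r : ℂ) ^ n * laurentCoeff r g n := by
    intro n
    rw [fourierCoeff_eq_intervalIntegral _ _ 0, laurentCoeff, circleIntegral, zero_add, smul_eq_mul,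
      ← intervalIntegral.integral_const_mul, ← intervalIntegral.integral_const_mul,
      ← intervalIntegral.integral_smul]
    congr 1
    ext θ
    have h1 : circleMap 0 r θ = r * Complex.exp (θ * Complex.I) := by simp [circleMap]
    rw [deriv_circleMap, h1, fourier_coe_apply]
    have h2 : Complex.exp (2 * Real.pi * Complex.I * (-n : ℤ) * θ / (2 * Real.pi : ℝ)) =
        Complex.exp (θ * Complex.I) ^ (-n) := by
      rw [← Complex.exp_int_mul]
      congr 1
      push_cast
      field_simp
    rw [h2]
    have h3 : G (θ : AddCircle (2 * Real.pi)) = g (r * Complex.exp (θ * Complex.I)) := by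
      change g (r * (AddCircle.toCircle (θ : AddCircle (2 * Real.pi)) : ℂ)) = _
      rw [hexp]
    rw [h3]
    have he : Complex.exp (θ * Complex.I) ≠ 0 := Complex.exp_ne_zero _
    generalize Complex.exp (θ * Complex.I) = e at he
    rw [mul_zpow, zpow_sub_one₀ he, zpow_sub_one₀ hrc, zpow_neg (r : ℂ)]
    have hI := Complex.I_ne_zero
    have hrn : (r : ℂ) ^ n ≠ 0 := zpow_ne_zero _ hrc
    simp only [smul_eq_mul, Complex.real_smul]
    push_cast
    field_simp
  have h := has_pointwise_sum_fourier_series_of_summable (f := G)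
    ((funext hcoef : fourierCoeff G = _) ▸ hs) ((Complex.arg w : ℝ) : AddCircle (2 * Real.pi))
  have hwe : (r : ℂ) * Complex.exp (Complex.arg w * Complex.I) = w := by
    rw [← hw]; exact Complex.norm_mul_exp_arg_mul_I w
  have hGw : G ((Complex.arg w : ℝ) : AddCircle (2 * Real.pi)) = g w := by
    change g (r * (AddCircle.toCircle ((Complex.arg w : ℝ) : AddCircle (2 * Real.pi)) : ℂ)) = _
    rw [hexp, hwe]
  rw [hGw] at h
  convert! h using 2 with n
  rw [hcoef, fourier_coe_apply, smul_eq_mul]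
  have h2 : Complex.exp (2 * Real.pi * Complex.I * n * (Complex.arg w : ℝ) / (2 * Real.pi : ℝ)) =
      Complex.exp (Complex.arg w * Complex.I) ^ n := by
    rw [← Complex.exp_int_mul]
    congr 1
    push_cast
    field_simp
  rw [h2]
  conv_lhs => rw [← hwe, mul_zpow]
  ring

/-! ### Weights against geometric decay -/

lemma LoopTopology.one_le_weight (T : LoopTopology) (n : ℤ) : 1 ≤ T.weight n := by
  cases T with
  | sobolev s hs => exact Real.one_le_rpow (by nlinarith [sq_nonneg (n : ℝ)]) (by linarith)
  | wiener w hw => exact hw.one_le n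

lemma summable_int_natAbs {f : ℕ → ℝ} (hf : Summable f) : Summable fun n : ℤ => f n.natAbs :=
  Summable.of_nat_of_neg (by simpa using hf) (by simpa using hf)

/-- All admissible weights grow subexponentially: polynomially for H^s, and by the root condition
for Wiener weights. This is the only property of the topology, besides positivity, on which the
decay estimate for loops rests. -/
lemma LoopTopology.summable_weight (T : LoopTopology) {q : ℝ} (h0 : 0 < q) (h1 : q < 1) :
    Summable fun n : ℤ => T.weight n * q ^ n.natAbs := by
  cases T with
  | sobolev s hs =>
    obtain ⟨N, hN⟩ := exists_nat_ge s
    have hs1 : Summable fun n : ℕ => ((n : ℝ) + 1) ^ N * q ^ n := by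
      have h2 := (summable_nat_add_iff 1).2
        (summable_pow_mul_geometric_of_norm_lt_one N (r := q) (by
          rw [Real.norm_of_nonneg h0.le]; exact h1))
      refine (h2.mul_left q⁻¹).congr fun n => ?_
      push_cast
      rw [pow_succ q]
      field_simp
    refine Summable.of_nonneg_of_le (fun n => ?_) (fun n => ?_) (summable_int_natAbs hs1)
    · exact mul_nonneg (zero_le_one.trans (one_le_weight _ n)) (by positivity)
    · refine mul_le_mul_of_nonneg_right ?_ (by positivity)
      change (1 + (n : ℝ) ^ 2) ^ (s / 2) ≤ _
      have hn : (n : ℝ) ^ 2 = (n.natAbs : ℝ) ^ 2 := by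
        rw [Nat.cast_natAbs, Int.cast_abs, sq_abs]
      have hx : (0 : ℝ) ≤ n.natAbs := Nat.cast_nonneg _
      calc (1 + (n : ℝ) ^ 2) ^ (s / 2) ≤ (((n.natAbs : ℝ) + 1) ^ 2) ^ (s / 2) :=
            Real.rpow_le_rpow (by positivity) (by rw [hn]; nlinarith) (by linarith)
        _ = ((n.natAbs : ℝ) + 1) ^ s := by
            rw [← Real.rpow_natCast, ← Real.rpow_mul (by positivity)]
            congr 1; push_cast; ring
        _ ≤ ((n.natAbs : ℝ) + 1) ^ (N : ℝ) := Real.rpow_le_rpow_of_exponent_le (by linarith) hN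
        _ = _ := Real.rpow_natCast _ _
  | wiener w hw =>
    -- With 1 < Q < 1/q the root condition gives w n ≤ Q^|n| for all but finitely many n, and Q q is
    -- still below 1.
    obtain ⟨Q, hQ1, hQ2⟩ := exists_between ((one_lt_inv₀ h0).2 h1)
    have hQq : Q * q < 1 := by rwa [← lt_div_iff₀ h0, one_div]
    have hQ0 : 0 < Q := by linarith
    refine Summable.of_norm_bounded_eventually
      (summable_int_natAbs (summable_geometric_of_lt_one (r := Q * q) (by positivity) hQq)) ?_
    have hne : ∀ᶠ n : ℤ in cofinite, n ≠ 0 := (finite_singleton (0 : ℤ)).compl_mem_cofinite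
    filter_upwards [hw.subexp.eventually_lt_const hQ1, hne] with n hn hn0
    have hw0 : 0 < w n := by linarith [hw.one_le n]
    have habs : (n.natAbs : ℝ) = |(n : ℝ)| := by rw [Nat.cast_natAbs, Int.cast_abs]
    have hpos : 0 < |(n : ℝ)| := abs_pos.2 (by exact_mod_cast hn0)
    have h2 : w n ≤ Q ^ n.natAbs := by
      calc w n = (w n ^ (1 / |(n : ℝ)|)) ^ n.natAbs := by
            rw [← Real.rpow_natCast, ← Real.rpow_mul hw0.le, habs, one_div,
              inv_mul_cancel₀ hpos.ne', Real.rpow_one]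
        _ ≤ _ := pow_le_pow_left₀ (by positivity) hn.le _
    change ‖w n * q ^ n.natAbs‖ ≤ _
    rw [Real.norm_of_nonneg (by positivity), mul_pow]
    exact mul_le_mul_of_nonneg_right h2 (by positivity)

/-- The outer circle controls the coefficients with n ≥ 0 and the inner one those with n ≤ 0; the
maximum is a ratio valid for both. -/
lemma zpow_mul_le {r ρ₁ ρ₂ a M : ℝ} (h0 : 0 < ρ₁) (h1 : ρ₁ < r) (h2 : r < ρ₂) (hM : 0 ≤ M) {n : ℤ}
    (ha1 : a ≤ M * ρ₁ ^ (-n)) (ha2 : a ≤ M * ρ₂ ^ (-n)) :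
    r ^ n * a ≤ M * max (ρ₁ / r) (r / ρ₂) ^ n.natAbs := by
  have hr : 0 < r := h0.trans h1
  have hρ₂ : 0 < ρ₂ := hr.trans h2
  obtain ⟨k, rfl | rfl⟩ := n.eq_nat_or_neg
  · rw [Int.natAbs_natCast]
    calc r ^ (k : ℤ) * a ≤ r ^ (k : ℤ) * (M * ρ₂ ^ (-(k : ℤ))) :=
          mul_le_mul_of_nonneg_left ha2 (by positivity)
      _ = M * (r / ρ₂) ^ k := by
          rw [zpow_neg, zpow_natCast, zpow_natCast, div_pow]; ring
      _ ≤ _ := by gcongr; exact le_max_right _ _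
  · rw [Int.natAbs_neg, Int.natAbs_natCast]
    rw [neg_neg] at ha1
    calc r ^ (-(k : ℤ)) * a ≤ r ^ (-(k : ℤ)) * (M * ρ₁ ^ (k : ℤ)) :=
          mul_le_mul_of_nonneg_left ha1 (by positivity)
      _ = M * (ρ₁ / r) ^ k := by
          rw [zpow_neg, zpow_natCast, zpow_natCast, div_pow]; ring
      _ ≤ _ := by gcongr; exact le_max_left _ _

/-- A family of functions that is holomorphic on `V` times an annulus around `C_r` is a holomorphic
map from `V` to each of the Banach spaces `𝒜_r`. -/
theorem exists_coeffs_of_differentiableOn (T : LoopTopology) {r₁ r r₂ : ℝ} (h0 : 0 ≤ r₁)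
    (h₁ : r₁ < r) (h₂ : r < r₂) {V : Set ℂ} (hV : IsOpen V) {f : ℂ → ℂ → ℂ}
    (hc : ContinuousOn (fun p : ℂ × ℂ => f p.1 p.2) (V ×ˢ annulus r₁ r₂))
    (hz : ∀ w ∈ annulus r₁ r₂, DifferentiableOn ℂ (fun z => f z w) V)
    (hw : ∀ z ∈ V, DifferentiableOn ℂ (f z) (annulus r₁ r₂)) :
    ∃ F : ℂ → T.Coeffs, DifferentiableOn ℂ F V ∧ ∀ z ∈ V, Represents T r (F z) (f z) := by
  have hr : 0 < r := h0.trans_lt h₁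
  have hrc : (r : ℂ) ≠ 0 := by exact_mod_cast hr.ne'
  obtain ⟨ρ₁, hρ₁, hρ₁r⟩ := exists_between h₁
  obtain ⟨ρ₂, hrρ₂, hρ₂⟩ := exists_between h₂
  have hρ₁0 : 0 < ρ₁ := h0.trans_lt hρ₁
  have hρ₂0 : 0 < ρ₂ := hr.trans hrρ₂
  set q := max (ρ₁ / r) (r / ρ₂) with hq
  have hq0 : 0 < q := lt_max_of_lt_left (by positivity)
  have hq1 : q < 1 := max_lt ((div_lt_one hr).2 hρ₁r) ((div_lt_one hρ₂0).2 hrρ₂)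
  have hws := T.summable_weight hq0 hq1
  have hpos : ∀ n, 0 < T.weight n := fun n => zero_lt_one.trans_le (T.one_le_weight n)
  set c : ℤ → ℂ → ℂ := fun n z => (T.weight n : ℂ) * ((r : ℂ) ^ n * laurentCoeff r (f z) n) with hcdef
  have hcd : ∀ n, DifferentiableOn ℂ (c n) V := by
    intro n
    have hs := sphere_subset_annulus h₁ h₂
    have := differentiableOn_circleIntegral hV (c := 0) hr.le (f := fun z w => w ^ (-n - 1) * f z w)
      (ContinuousOn.mul (fun p hp => by
        have hp2 : p.2 ≠ 0 := ne_zero_of_mem_annulus h0 (hs hp.2)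
        exact ((continuousAt_zpow₀ p.2 (-n - 1) (Or.inl hp2)).comp
          continuousAt_snd).continuousWithinAt) (hc.mono (prod_mono_right hs)))
      (fun w hw' => (hz w (hs hw')).const_mul _)
    exact ((this.const_smul (2 * Real.pi * Complex.I : ℂ)⁻¹).const_mul _).const_mul _
  have hloc : ∀ z₀ ∈ V, ∃ W ⊆ V, IsOpen W ∧ z₀ ∈ W ∧ ∃ M, 0 ≤ M ∧ ∀ n, ∀ z ∈ W,
      ‖(r : ℂ) ^ n * laurentCoeff r (f z) n‖ ≤ M * q ^ n.natAbs := by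
    intro z₀ hz₀
    obtain ⟨R, hR, hRV⟩ := Metric.nhds_basis_closedBall.mem_iff.1 (hV.mem_nhds hz₀)
    have hs1 := sphere_subset_annulus hρ₁ (hρ₁r.trans h₂)
    have hs2 := sphere_subset_annulus (h₁.trans hrρ₂) hρ₂
    obtain ⟨M, hM⟩ := ((isCompact_closedBall z₀ R).prod
      ((isCompact_sphere (0 : ℂ) ρ₁).union (isCompact_sphere (0 : ℂ) ρ₂))).exists_bound_of_continuousOn
      (hc.mono (prod_mono hRV (union_subset hs1 hs2)))
    have hM0 : 0 ≤ M := by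
      obtain ⟨w, hw'⟩ : (Metric.sphere (0 : ℂ) ρ₁).Nonempty :=
        NormedSpace.sphere_nonempty.2 hρ₁0.le
      exact (norm_nonneg _).trans (hM (z₀, w) ⟨Metric.mem_closedBall_self hR.le, Or.inl hw'⟩)
    refine ⟨Metric.ball z₀ R, Metric.ball_subset_closedBall.trans hRV, Metric.isOpen_ball,
      Metric.mem_ball_self hR, M, hM0, fun n z hzW => ?_⟩
    have hzc := Metric.ball_subset_closedBall hzW
    have e1 : ‖laurentCoeff r (f z) n‖ ≤ M * ρ₁ ^ (-n) := by
      rw [laurentCoeff_eq h0 hρ₁ hρ₁r.le h₂ (hw z (hRV hzc))]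
      exact norm_laurentCoeff_le hρ₁0 (fun w hw' => hM (z, w) ⟨hzc, Or.inl hw'⟩) n
    have e2 : ‖laurentCoeff r (f z) n‖ ≤ M * ρ₂ ^ (-n) := by
      rw [← laurentCoeff_eq h0 h₁ hrρ₂.le hρ₂ (hw z (hRV hzc))]
      exact norm_laurentCoeff_le hρ₂0 (fun w hw' => hM (z, w) ⟨hzc, Or.inr hw'⟩) n
    rw [norm_mul, norm_zpow, Complex.norm_real, Real.norm_of_nonneg hr.le]
    exact zpow_mul_le hρ₁0 hρ₁r hrρ₂ hM0 e1 e2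
  have hp0 : 0 < T.exponent := zero_lt_one.trans_le (Fact.out : 1 ≤ T.exponent)
  have hnorm : ∀ (n : ℤ) (z : ℂ) (M : ℝ),
      ‖(r : ℂ) ^ n * laurentCoeff r (f z) n‖ ≤ M * q ^ n.natAbs →
      ‖c n z • lp.single (E := fun _ : ℤ => ℂ) T.exponent n (1 : ℂ)‖ ≤
        M * (T.weight n * q ^ n.natAbs) := by
    intro n z M h
    rw [norm_smul, lp.norm_single hp0, norm_one, mul_one, hcdef, norm_mul, Complex.norm_real,
      Real.norm_of_nonneg (hpos n).le]
    calc _ ≤ T.weight n * (M * q ^ n.natAbs) := mul_le_mul_of_nonneg_left h (hpos n).le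
      _ = _ := by ring
  -- The basis vectors have norm 1 for either summability exponent, so the same M-test gives a
  -- normally convergent series of holomorphic maps in every `T.Coeffs`.
  refine ⟨fun z => ∑' n : ℤ, c n z • lp.single (E := fun _ : ℤ => ℂ) T.exponent n (1 : ℂ), ?_, ?_⟩
  · intro z₀ hz₀
    obtain ⟨W, hWV, hWo, hzW, M, hM0, hM⟩ := hloc z₀ hz₀
    have := Complex.differentiableOn_tsum_of_summable_norm (hws.mul_left M)
      (F := fun n z => c n z • lp.single (E := fun _ : ℤ => ℂ) T.exponent n (1 : ℂ)) (U := W)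
      (fun n => ((hcd n).mono hWV).smul_const _) hWo fun n z hz' => hnorm n z M (hM n z hz')
    exact (this.differentiableAt (hWo.mem_nhds hzW)).differentiableWithinAt
  · intro z hzV w hwr
    obtain ⟨W, hWV, hWo, hzW, M, hM0, hM⟩ := hloc z hzV
    have hsum : Summable fun n : ℤ => c n z • lp.single (E := fun _ : ℤ => ℂ) T.exponent n (1 : ℂ) :=
      Summable.of_norm_bounded (hws.mul_left M) fun n => hnorm n z M (hM n z hzW)
    have hcoord : ∀ m : ℤ, (∑' n : ℤ, c n z • lp.single (E := fun _ : ℤ => ℂ) T.exponent n (1 : ℂ) :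
        T.Coeffs) m = c m z := by
      intro m
      have h := (lp.evalCLM ℂ (fun _ : ℤ => ℂ) T.exponent m).hasSum hsum.hasSum
      refine h.unique ?_
      refine (hasSum_ite_eq m (c m z)).congr_fun fun n => ?_
      change (c n z • lp.single (E := fun _ : ℤ => ℂ) T.exponent n (1 : ℂ) : T.Coeffs) m = _
      by_cases hmn : n = m
      · subst hmn; simp
      · simp [hmn, Ne.symm hmn]
    have hsphere : Metric.sphere (0 : ℂ) r ⊆ annulus r₁ r₂ := sphere_subset_annulus h₁ h₂
    have h := hasSum_laurentCoeff hr ((hw z hzV).continuousOn.mono hsphere)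
      (Summable.of_norm_bounded (((summable_int_natAbs
        (summable_geometric_of_lt_one hq0.le hq1)).mul_left M)) fun n => hM n z hzW) hwr
    refine h.congr_fun fun n => ?_
    have hwn : (T.weight n : ℂ) ≠ 0 := by exact_mod_cast (hpos n).ne'
    have hrn : (r : ℂ) ^ n ≠ 0 := zpow_ne_zero _ hrc
    rw [hcoord, hcdef, div_zpow]
    field_simp

/-! ### Taylor coefficients -/

section Taylor

variable {F : Type*} [NormedAddCommGroup F] [NormedSpace ℂ F] [CompleteSpace F]

/-- The Taylor coefficients at `0`. -/
noncomputable def taylorCoeff (n : ℕ) (f : ℂ → F) : F := (n.factorial : ℂ)⁻¹ • iteratedDeriv n f 0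

omit [CompleteSpace F] in
lemma taylorCoeff_zero (f : ℂ → F) : taylorCoeff 0 f = f 0 := by simp [taylorCoeff]

lemma hasSum_taylorCoeff {ρ : ℝ} {f : ℂ → F} (hf : DifferentiableOn ℂ f (Metric.ball 0 ρ)) {z : ℂ}
    (hz : ‖z‖ < ρ) : HasSum (fun n : ℕ => z ^ n • taylorCoeff n f) (f z) := by
  refine (Complex.hasSum_taylorSeries_on_ball hf (by simpa using hz)).congr_fun fun n => ?_
  rw [taylorCoeff, smul_comm, sub_zero]

lemma norm_taylorCoeff_le {ρ M : ℝ} (hρ : 0 < ρ) {f : ℂ → F}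
    (hf : DifferentiableOn ℂ f (Metric.closedBall 0 ρ))
    (hM : ∀ z ∈ Metric.sphere (0 : ℂ) ρ, ‖f z‖ ≤ M) (n : ℕ) : ‖taylorCoeff n f‖ ≤ M / ρ ^ n := by
  have hn : (0 : ℝ) < n.factorial := by exact_mod_cast n.factorial_pos
  have h := Complex.norm_iteratedDeriv_le_of_forall_mem_sphere_norm_le n hρ
    (DifferentiableOn.diffContOnCl (by rwa [closure_ball _ hρ.ne'])) hM
  rw [taylorCoeff, norm_smul, norm_inv, Complex.norm_natCast, inv_mul_le_iff₀ hn]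
  refine h.trans_eq ?_
  ring

/-- Cauchy's formula turns the coefficient into an integral of f over a fixed circle, which depends
holomorphically on w. -/
lemma differentiableOn_taylorCoeff {V S : Set ℂ} (hV : IsOpen V) (h0 : (0 : ℂ) ∈ V) (hS : IsOpen S)
    {f : ℂ → ℂ → F} (hc : ContinuousOn (fun p : ℂ × ℂ => f p.1 p.2) (V ×ˢ S))
    (h₁ : ∀ w ∈ S, DifferentiableOn ℂ (fun z => f z w) V)
    (h₂ : ∀ z ∈ V, DifferentiableOn ℂ (f z) S) (n : ℕ) :
    DifferentiableOn ℂ (fun w => taylorCoeff n fun z => f z w) S := by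
  obtain ⟨R, hR, hRV⟩ := Metric.nhds_basis_closedBall.mem_iff.1 (hV.mem_nhds h0)
  have hs : Metric.sphere (0 : ℂ) R ⊆ V := Metric.sphere_subset_closedBall.trans hRV
  have key := differentiableOn_circleIntegral hS (c := 0) hR.le
    (f := fun w z => (1 / (z - 0) ^ (n + 1)) • f z w)
    (ContinuousOn.smul (fun p hp => by
        have hp2 : (p.2 - 0) ^ (n + 1) ≠ 0 := by
          have : ‖p.2‖ = R := mem_sphere_zero_iff_norm.1 hp.2
          refine pow_ne_zero _ ?_
          rw [sub_zero, ← norm_pos_iff, this]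
          exact hR
        refine ContinuousAt.continuousWithinAt ?_
        fun_prop (disch := exact hp2))
      (hc.comp (continuous_snd.prodMk continuous_fst).continuousOn fun p hp => ⟨hs hp.2, hp.1⟩))
    fun z hz => (h₂ z (hs hz)).const_smul (1 / (z - 0) ^ (n + 1))
  have hpi : (2 * Real.pi * Complex.I : ℂ) ≠ 0 := Complex.two_pi_I_ne_zero
  refine (key.const_smul (2 * Real.pi * Complex.I : ℂ)⁻¹).congr fun w hw => ?_
  have hn : (n.factorial : ℂ) ≠ 0 := by exact_mod_cast n.factorial_ne_zero
  rw [Pi.smul_apply, DifferentiableOn.circleIntegral_one_div_sub_center_pow_smul hR n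
    ((h₁ w hw).mono hRV), smul_smul, taylorCoeff]
  congr 1
  field_simp

end Taylor

/-! ### Fuchsian systems -/

/-- A discrete Gronwall inequality. -/
lemma exists_geometric_bound {b y : ℝ} (hb : 0 ≤ b) (hy : 1 < y) :
    ∃ K : ℝ, ∀ q : ℕ → ℝ, (∀ k, 0 ≤ q k) →
      (∀ k, 1 ≤ k → q k ≤ b / k * ∑ i ∈ Finset.range k, q i) → ∀ k, q k ≤ K * q 0 * y ^ k := by
  -- From k₀ on, b/k ≤ y − 1 and the geometric sum with ratio y closes the induction. Below k₀ the
  -- crude ratio 1 + b suffices and is absorbed into the constant (1 + b)^k₀, which does not depend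
  -- on q.
  obtain ⟨k₀, hk₀⟩ := exists_nat_ge (b / (y - 1))
  have hy1 : 0 < y - 1 := by linarith
  refine ⟨(1 + b) ^ k₀, fun q hq h => ?_⟩
  have hgeom : ∀ k, q k ≤ q 0 * (1 + b) ^ k := by
    intro k
    induction k using Nat.strong_induction_on with
    | _ k ih =>
      rcases Nat.eq_zero_or_pos k with rfl | hk
      · simp
      have h1 : ∑ i ∈ Finset.range k, q i ≤ ∑ i ∈ Finset.range k, q 0 * (1 + b) ^ i :=
        Finset.sum_le_sum fun i hi => ih i (Finset.mem_range.1 hi)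
      have h2 : (∑ i ∈ Finset.range k, (1 + b) ^ i) * b = (1 + b) ^ k - 1 := by
        simpa using geom_sum_mul (1 + b) k
      have hk1 : (1 : ℝ) ≤ k := by exact_mod_cast hk
      calc q k ≤ b / k * ∑ i ∈ Finset.range k, q i := h k hk
        _ ≤ b * ∑ i ∈ Finset.range k, q i :=
            mul_le_mul_of_nonneg_right (div_le_self hb hk1) (Finset.sum_nonneg fun i _ => hq i)
        _ ≤ b * ∑ i ∈ Finset.range k, q 0 * (1 + b) ^ i := mul_le_mul_of_nonneg_left h1 hb
        _ = q 0 * ((1 + b) ^ k - 1) := by rw [← Finset.mul_sum, ← h2]; ring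
        _ ≤ q 0 * (1 + b) ^ k := mul_le_mul_of_nonneg_left (by linarith) (hq 0)
  intro k
  induction k using Nat.strong_induction_on with
  | _ k ih =>
    have hq0 := hq 0
    rcases lt_or_ge k k₀ with hk | hk
    · calc q k ≤ q 0 * (1 + b) ^ k := hgeom k
        _ ≤ q 0 * (1 + b) ^ k₀ :=
            mul_le_mul_of_nonneg_left (pow_le_pow_right₀ (by linarith) hk.le) hq0
        _ = (1 + b) ^ k₀ * q 0 * 1 := by ring
        _ ≤ _ := mul_le_mul_of_nonneg_left (one_le_pow₀ hy.le) (by positivity)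
    · rcases Nat.eq_zero_or_pos k with rfl | hk0
      · have : k₀ = 0 := by omega
        simp [this]
      have hkr : (0 : ℝ) < k := by exact_mod_cast hk0
      have hbk : b / k ≤ y - 1 := by
        rw [div_le_iff₀ hkr, mul_comm, ← div_le_iff₀ hy1]
        exact hk₀.trans (by exact_mod_cast hk)
      have h1 : ∑ i ∈ Finset.range k, q i ≤ ∑ i ∈ Finset.range k, (1 + b) ^ k₀ * q 0 * y ^ i :=
        Finset.sum_le_sum fun i hi => ih i (Finset.mem_range.1 hi)
      have h2 := geom_sum_mul y k
      calc q k ≤ b / k * ∑ i ∈ Finset.range k, q i := h k hk0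
        _ ≤ (y - 1) * ∑ i ∈ Finset.range k, q i :=
            mul_le_mul_of_nonneg_right hbk (Finset.sum_nonneg fun i _ => hq i)
        _ ≤ (y - 1) * ∑ i ∈ Finset.range k, (1 + b) ^ k₀ * q 0 * y ^ i :=
            mul_le_mul_of_nonneg_left h1 hy1.le
        _ = (1 + b) ^ k₀ * q 0 * (y ^ k - 1) := by rw [← Finset.mul_sum, ← h2]; ring
        _ ≤ _ := mul_le_mul_of_nonneg_left (by linarith) (by positivity)

section Fuchsian

variable {E : Type*} [NormedAddCommGroup E] [NormedSpace ℂ E]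

/-- The coefficients of the power series solution of `z P' = A P`, `P(0) = v`, where
`A = ∑ a_j z^j`. -/
noncomputable def frobeniusCoeff (a : ℕ → E →L[ℂ] E) (v : E) : ℕ → E
  | 0 => v
  -- Comparing coefficients gives (k − a 0) p_k = ∑_{i<k} a_{k−i} p_i. `Ring.inverse` is 0 off the
  -- units, so nonresonance enters only when the recursion is verified.
  | k + 1 => Ring.inverse (((k + 1 : ℕ) : ℂ) • (1 : E →L[ℂ] E) - a 0)
      (∑ i : Fin (k + 1), a (k + 1 - i) (frobeniusCoeff a v i))

lemma frobeniusCoeff_zero (a : ℕ → E →L[ℂ] E) (v : E) : frobeniusCoeff a v 0 = v := by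
  rw [frobeniusCoeff]

lemma frobeniusCoeff_of_pos (a : ℕ → E →L[ℂ] E) (v : E) {k : ℕ} (hk : 1 ≤ k) :
    frobeniusCoeff a v k = Ring.inverse ((k : ℂ) • (1 : E →L[ℂ] E) - a 0)
      (∑ i ∈ Finset.range k, a (k - i) (frobeniusCoeff a v i)) := by
  obtain ⟨k, rfl⟩ := Nat.exists_eq_add_of_le' hk
  rw [frobeniusCoeff, Finset.sum_range]

lemma smul_frobeniusCoeff {a : ℕ → E →L[ℂ] E} {v : E} (hv : a 0 v = 0)
    (hu : ∀ k : ℕ, 1 ≤ k → IsUnit ((k : ℂ) • (1 : E →L[ℂ] E) - a 0)) (k : ℕ) :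
    (k : ℂ) • frobeniusCoeff a v k =
      ∑ i ∈ Finset.range (k + 1), a (k - i) (frobeniusCoeff a v i) := by
  rcases Nat.eq_zero_or_pos k with rfl | hk
  · simp [frobeniusCoeff_zero, hv]
  have h := congrArg (fun T : E →L[ℂ] E => T (∑ i ∈ Finset.range k, a (k - i) (frobeniusCoeff a v i)))
    (Ring.mul_inverse_cancel _ (hu k hk))
  simp only [mul_apply_eq_comp, ← frobeniusCoeff_of_pos a v hk] at h
  rw [Finset.sum_range_succ, Nat.sub_self]
  simpa [sub_eq_iff_eq_add] using h

/-- The numbers ‖p_k‖ ρ^k satisfy the discrete Gronwall inequality with b = C M. The factor 1/k from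
the resolvent permits every y > 1, so no radius of convergence is lost; K depends only on b and y,
hence is uniform in parameters. -/
lemma norm_frobeniusCoeff_le {b y : ℝ} (hb : 0 ≤ b) (hy : 1 < y) :
    ∃ K : ℝ, ∀ (a : ℕ → E →L[ℂ] E) (v : E) (C M ρ : ℝ), 0 < ρ → 0 ≤ C → C * M = b →
      (∀ k : ℕ, 1 ≤ k → ‖Ring.inverse ((k : ℂ) • (1 : E →L[ℂ] E) - a 0)‖ ≤ C / k) →
      (∀ j, ‖a j‖ ≤ M / ρ ^ j) →
      ∀ k, ‖frobeniusCoeff a v k‖ ≤ K * ‖v‖ * (y / ρ) ^ k := by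
  obtain ⟨K, hK⟩ := exists_geometric_bound hb hy
  refine ⟨K, fun a v C M ρ hρ hC hCM hR ha k => ?_⟩
  have h := hK (fun k => ‖frobeniusCoeff a v k‖ * ρ ^ k) (fun k => by positivity)
    (fun k hk => ?_) k
  · simp only [frobeniusCoeff_zero, pow_zero, mul_one] at h
    rw [div_pow, mul_div_assoc', le_div_iff₀ (by positivity)]
    exact h
  · rw [frobeniusCoeff_of_pos a v hk]
    have h1 : ‖∑ i ∈ Finset.range k, a (k - i) (frobeniusCoeff a v i)‖ * ρ ^ k ≤
        M * ∑ i ∈ Finset.range k, ‖frobeniusCoeff a v i‖ * ρ ^ i := by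
      rw [Finset.mul_sum]
      refine (mul_le_mul_of_nonneg_right (norm_sum_le _ _) (by positivity)).trans ?_
      rw [Finset.sum_mul]
      refine Finset.sum_le_sum fun i hi => ?_
      have hi' := (Finset.mem_range.1 hi).le
      have hpow : ρ ^ k = ρ ^ (k - i) * ρ ^ i := by rw [← pow_add, Nat.sub_add_cancel hi']
      have h2 : ‖a (k - i) (frobeniusCoeff a v i)‖ ≤ M / ρ ^ (k - i) * ‖frobeniusCoeff a v i‖ :=
        ((a (k - i)).le_opNorm _).trans (mul_le_mul_of_nonneg_right (ha _) (norm_nonneg _))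
      refine (mul_le_mul_of_nonneg_right h2 (by positivity)).trans_eq ?_
      rw [hpow]
      field_simp
    calc _ ≤ C / k * ‖∑ i ∈ Finset.range k, a (k - i) (frobeniusCoeff a v i)‖ * ρ ^ k := by
          refine mul_le_mul_of_nonneg_right ?_ (by positivity)
          exact (ContinuousLinearMap.le_opNorm _ _).trans
            (mul_le_mul_of_nonneg_right (hR k hk) (norm_nonneg _))
      _ = C / k * (‖∑ i ∈ Finset.range k, a (k - i) (frobeniusCoeff a v i)‖ * ρ ^ k) := by ring
      _ ≤ C / k * (M * ∑ i ∈ Finset.range k, ‖frobeniusCoeff a v i‖ * ρ ^ i) :=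
          mul_le_mul_of_nonneg_left h1 (by positivity)
      _ = _ := by rw [← hCM]; ring

variable [CompleteSpace E]

/-- The resolvents `(k - L)⁻¹`, `k ≥ 1`, are `O(1/k)` uniformly on compact families. -/
lemma exists_norm_inverse_le {K : Set ℂ} (hK : IsCompact K) {L : ℂ → E →L[ℂ] E}
    (hL : ContinuousOn L K)
    (hu : ∀ w ∈ K, ∀ k : ℕ, 1 ≤ k → IsUnit ((k : ℂ) • (1 : E →L[ℂ] E) - L w)) :
    ∃ C : ℝ, 0 ≤ C ∧ ∀ k : ℕ, 1 ≤ k → ∀ w ∈ K,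
      ‖Ring.inverse ((k : ℂ) • (1 : E →L[ℂ] E) - L w)‖ ≤ C / k := by
  obtain ⟨α, hα⟩ := hK.exists_bound_of_continuousOn hL
  -- For k ≥ 2α the identity k z = x + L z gives ‖z‖ ≤ (2/k)‖x‖ directly; the finitely many smaller
  -- k are bounded by compactness.
  obtain ⟨k₁, hk₁⟩ := exists_nat_ge (2 * α)
  have hfin : ∀ k : ℕ, ∃ c : ℝ, 0 ≤ c ∧ (1 ≤ k → ∀ w ∈ K,
      ‖Ring.inverse ((k : ℂ) • (1 : E →L[ℂ] E) - L w)‖ ≤ c) := by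
    intro k
    by_cases hk : 1 ≤ k
    · have hc : ContinuousOn (fun w => Ring.inverse ((k : ℂ) • (1 : E →L[ℂ] E) - L w)) K := by
        intro w hw
        obtain ⟨u, hu'⟩ := hu w hw k hk
        have h1 : ContinuousAt Ring.inverse ((k : ℂ) • (1 : E →L[ℂ] E) - L w) := by
          rw [← hu']; exact NormedRing.inverse_continuousAt u
        exact h1.comp_continuousWithinAt (f := fun w => (k : ℂ) • (1 : E →L[ℂ] E) - L w)
          (continuousWithinAt_const.sub (hL w hw))
      obtain ⟨c, hc⟩ := hK.exists_bound_of_continuousOn hc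
      exact ⟨max c 0, le_max_right _ _, fun _ w hw => (hc w hw).trans (le_max_left _ _)⟩
    · exact ⟨0, le_rfl, fun h => absurd h hk⟩
  choose c hc0 hc using hfin
  have hs : 0 ≤ ∑ k ∈ Finset.range k₁, k * c k :=
    Finset.sum_nonneg fun i _ => mul_nonneg (Nat.cast_nonneg _) (hc0 i)
  refine ⟨2 + ∑ k ∈ Finset.range k₁, k * c k, by positivity, fun k hk w hw => ?_⟩
  have hkr : (0 : ℝ) < k := by exact_mod_cast hk
  rw [le_div_iff₀ hkr]
  rcases lt_or_ge k k₁ with h | h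
  · have h1 : (k : ℝ) * c k ≤ ∑ k ∈ Finset.range k₁, k * c k :=
      Finset.single_le_sum (f := fun k : ℕ => (k : ℝ) * c k)
        (fun i _ => mul_nonneg (Nat.cast_nonneg _) (hc0 i)) (Finset.mem_range.2 h)
    have h2 := mul_le_mul_of_nonneg_right (hc k hk w hw) hkr.le
    linarith
  · have h1 : ‖Ring.inverse ((k : ℂ) • (1 : E →L[ℂ] E) - L w)‖ ≤ 2 / k := by
      refine ContinuousLinearMap.opNorm_le_bound _ (by positivity) fun x => ?_
      set z := Ring.inverse ((k : ℂ) • (1 : E →L[ℂ] E) - L w) x with hz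
      have h2 : (k : ℂ) • z - L w z = x := by
        have := congrArg (fun T : E →L[ℂ] E => T x) (Ring.mul_inverse_cancel _ (hu w hw k hk))
        simpa using this
      have h3 : k * ‖z‖ ≤ ‖x‖ + α * ‖z‖ := by
        have h4 : (k : ℂ) • z = x + L w z := by rw [← h2]; abel
        have h5 : ‖(k : ℂ) • z‖ = k * ‖z‖ := by rw [norm_smul, Complex.norm_natCast]
        rw [← h5, h4]
        refine (norm_add_le _ _).trans (add_le_add_right ?_ _)
        exact ((L w).le_opNorm z).trans (mul_le_mul_of_nonneg_right (hα w hw) (norm_nonneg _))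
      have h6 : 2 * α ≤ k := hk₁.trans (by exact_mod_cast h)
      rw [div_mul_eq_mul_div, le_div_iff₀ hkr]
      nlinarith [norm_nonneg z]
    rw [le_div_iff₀ hkr] at h1
    linarith

end Fuchsian

/-! ### Fuchsian systems with a holomorphic parameter -/

section Fuchsian

variable {E : Type*} [NormedAddCommGroup E] [NormedSpace ℂ E]

/-- The system `z P' = A(z, w) P`, `P(0, w) = v w` has coefficients that are holomorphic on
`V × S`, and the positive integers are not eigenvalues of `A(0, w)`. -/
structure IsFuchsian (V S : Set ℂ) (A : ℂ → ℂ → E →L[ℂ] E) (v : ℂ → E) : Prop where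
  cont : ContinuousOn (fun p : ℂ × ℂ => A p.1 p.2) (V ×ˢ S)
  diff_left : ∀ w ∈ S, DifferentiableOn ℂ (fun z => A z w) V
  diff_right : ∀ z ∈ V, DifferentiableOn ℂ (A z) S
  nonresonant : ∀ w ∈ S, ∀ k : ℕ, 1 ≤ k → IsUnit ((k : ℂ) • (1 : E →L[ℂ] E) - A 0 w)
  diff_initial : DifferentiableOn ℂ v S
  initial : ∀ w ∈ S, A 0 w (v w) = 0

/-- The coefficients of the power series solution of a Fuchsian system. -/
noncomputable def fuchsianCoeff (A : ℂ → ℂ → E →L[ℂ] E) (v : ℂ → E) (k : ℕ) (w : ℂ) : E :=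
  frobeniusCoeff (fun j => taylorCoeff j fun z => A z w) (v w) k

/-- The power series solution of a Fuchsian system. -/
noncomputable def fuchsianSolution (A : ℂ → ℂ → E →L[ℂ] E) (v : ℂ → E) (z w : ℂ) : E :=
  ∑' k : ℕ, z ^ k • fuchsianCoeff A v k w

lemma fuchsianSolution_zero (A : ℂ → ℂ → E →L[ℂ] E) (v : ℂ → E) (w : ℂ) :
    fuchsianSolution A v 0 w = v w := by
  rw [fuchsianSolution, tsum_eq_single 0 fun k hk => by simp [hk]]
  simp [fuchsianCoeff, frobeniusCoeff_zero]

variable [CompleteSpace E]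

omit [NormedSpace ℂ E] [CompleteSpace E] in
lemma hasSum_sum_antidiagonal {f : ℕ × ℕ → E} {x : E} (hf : HasSum f x) :
    HasSum (fun k => ∑ q ∈ Finset.HasAntidiagonal.antidiagonal k, f q) x := by
  have h2 := (Finset.HasAntidiagonal.sigmaAntidiagonalEquivProd.hasSum_iff (f := f)).2 hf
  exact h2.sigma (g := fun k => ∑ q ∈ Finset.HasAntidiagonal.antidiagonal k, f q)
    fun k => Finset.hasSum (Finset.HasAntidiagonal.antidiagonal k) f

omit [CompleteSpace E] in
lemma hasSum_clm_apply_const {a : ℕ → E →L[ℂ] E} {B : E →L[ℂ] E} (ha : HasSum a B) (x : E) :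
    HasSum (fun i => a i x) (B x) := by
  simpa only [ContinuousLinearMap.apply_apply] using (ContinuousLinearMap.apply ℂ E x).hasSum ha

/-- The Cauchy product of an operator valued power series and a vector valued one. -/
lemma hasSum_clm_apply {a : ℕ → E →L[ℂ] E} {p : ℕ → E} {B : E →L[ℂ] E} {x : E} (z : ℂ)
    (ha : HasSum (fun j => z ^ j • a j) B) (hp : HasSum (fun i => z ^ i • p i) x)
    (han : Summable fun j => ‖z ^ j • a j‖) (hpn : Summable fun i => ‖z ^ i • p i‖) :
    HasSum (fun k => z ^ k • ∑ i ∈ Finset.range (k + 1), a (k - i) (p i)) (B x) := by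
  have hfs : Summable fun q : ℕ × ℕ => (z ^ q.2 • a q.2) (z ^ q.1 • p q.1) := by
    refine Summable.of_norm_bounded (hpn.mul_of_nonneg han (fun _ => norm_nonneg _)
      fun _ => norm_nonneg _) fun q => ?_
    rw [mul_comm]
    exact ContinuousLinearMap.le_opNorm _ _
  have h1 : HasSum (fun i => B (z ^ i • p i))
      (∑' q : ℕ × ℕ, (z ^ q.2 • a q.2) (z ^ q.1 • p q.1)) :=
    hfs.hasSum.prod_fiberwise fun i => hasSum_clm_apply_const ha (z ^ i • p i)
  have h2 := B.hasSum hp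
  rw [h2.unique h1]
  refine (hasSum_sum_antidiagonal hfs.hasSum).congr_fun fun k => ?_
  rw [← Finset.Nat.sum_antidiagonal_eq_sum_range_succ fun i j => a j (p i), Finset.smul_sum]
  refine Finset.sum_congr rfl fun q hq => ?_
  rw [Finset.HasAntidiagonal.mem_antidiagonal] at hq
  rw [← hq, add_comm, pow_add, mul_smul, smul_apply, map_smul]

namespace IsFuchsian

variable {V S : Set ℂ} {A : ℂ → ℂ → E →L[ℂ] E} {v : ℂ → E}

omit [CompleteSpace E] in
lemma nonresonant_taylor (h : IsFuchsian V S A v) {w : ℂ} (hw : w ∈ S) (k : ℕ) (hk : 1 ≤ k) :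
    IsUnit ((k : ℂ) • (1 : E →L[ℂ] E) - taylorCoeff 0 fun z => A z w) := by
  rw [taylorCoeff_zero]; exact h.nonresonant w hw k hk

lemma differentiableOn_coeff (h : IsFuchsian V S A v) (hV : IsOpen V) (h0 : (0 : ℂ) ∈ V)
    (hS : IsOpen S) (k : ℕ) : DifferentiableOn ℂ (fuchsianCoeff A v k) S := by
  have ha := fun j => differentiableOn_taylorCoeff hV h0 hS h.cont h.diff_left h.diff_right j
  induction k using Nat.strong_induction_on with
  | _ k ih =>
    rcases Nat.eq_zero_or_pos k with rfl | hk
    · exact h.diff_initial.congr fun w _ => frobeniusCoeff_zero _ _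
    · have h1 : DifferentiableOn ℂ (fun w => Ring.inverse ((k : ℂ) • (1 : E →L[ℂ] E) -
          taylorCoeff 0 fun z => A z w)) S :=
        ((ha 0).const_sub _).inverse fun w hw => h.nonresonant_taylor hw k hk
      have h2 : DifferentiableOn ℂ (fun w => ∑ i ∈ Finset.range k,
          (taylorCoeff (k - i) fun z => A z w) (fuchsianCoeff A v i w)) S :=
        DifferentiableOn.fun_sum fun i hi => (ha (k - i)).clm_apply (ih i (Finset.mem_range.1 hi))
      exact (h1.clm_apply h2).congr fun w _ => frobeniusCoeff_of_pos _ _ hk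

lemma exists_summable_bound (h : IsFuchsian V S A v) {K : Set ℂ}
    (hK : IsCompact K) (hKS : K ⊆ S) {ρ ρ' : ℝ} (hρ' : 0 < ρ') (hρ : ρ' < ρ)
    (hρV : Metric.closedBall 0 ρ ⊆ V) :
    ∃ u : ℕ → ℝ, Summable u ∧ ∀ (k : ℕ), ∀ z ∈ Metric.closedBall (0 : ℂ) ρ', ∀ w ∈ K,
      ‖z ^ k • fuchsianCoeff A v k w‖ ≤ u k := by
  have hρ0 : 0 < ρ := hρ'.trans hρ
  have h0 : (0 : ℂ) ∈ V := hρV (Metric.mem_closedBall_self hρ0.le)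
  have hc0 : ContinuousOn (A 0) K :=
    ((h.diff_right 0 h0).continuousOn).mono hKS
  obtain ⟨C, hC0, hC⟩ := exists_norm_inverse_le hK hc0 fun w hw => h.nonresonant w (hKS hw)
  obtain ⟨M, hM⟩ := ((isCompact_sphere (0 : ℂ) ρ).prod hK).exists_bound_of_continuousOn
    (h.cont.mono (prod_mono (Metric.sphere_subset_closedBall.trans hρV) hKS))
  obtain ⟨N, hN⟩ := hK.exists_bound_of_continuousOn (h.diff_initial.continuousOn.mono hKS)
  -- Any y with 1 < y < ρ/ρ' makes the ratio y ρ'/ρ of the majorant less than 1.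
  obtain ⟨y, hy1, hy⟩ := exists_between ((one_lt_div hρ').2 hρ)
  obtain ⟨B, hB⟩ := norm_frobeniusCoeff_le (E := E) (b := C * max M 0) (by positivity) hy1
  have hx1 : y * ρ' / ρ < 1 := by
    rw [div_lt_one hρ0]
    exact (lt_div_iff₀ hρ').1 hy
  have hx0 : 0 ≤ y * ρ' / ρ := by
    have : 0 < y := by linarith
    positivity
  refine ⟨fun k => |B| * N * (y * ρ' / ρ) ^ k,
    (summable_geometric_of_lt_one hx0 hx1).mul_left _, fun k z hz w hw => ?_⟩
  have h1 := hB (fun j => taylorCoeff j fun z => A z w) (v w) C (max M 0) ρ hρ0 hC0 rfl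
    (fun k hk => by rw [taylorCoeff_zero]; exact hC k hk w hw)
    (fun j => norm_taylorCoeff_le hρ0 ((h.diff_left w (hKS hw)).mono hρV)
      (fun z hz => (hM (z, w) ⟨hz, hw⟩).trans (le_max_left _ _)) j) k
  rw [mem_closedBall_zero_iff] at hz
  have hN0 : 0 ≤ N := (norm_nonneg _).trans (hN w hw)
  have hy0 : 0 < y := by linarith
  have h3 : B * ‖v w‖ ≤ |B| * N :=
    (mul_le_mul_of_nonneg_right (le_abs_self B) (norm_nonneg _)).trans
      (mul_le_mul_of_nonneg_left (hN w hw) (abs_nonneg _))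
  rw [norm_smul, norm_pow]
  calc ‖z‖ ^ k * ‖fuchsianCoeff A v k w‖ ≤ ρ' ^ k * (|B| * N * (y / ρ) ^ k) := by
        refine mul_le_mul (pow_le_pow_left₀ (norm_nonneg _) hz k) (h1.trans ?_) (norm_nonneg _)
          (by positivity)
        exact mul_le_mul_of_nonneg_right h3 (by positivity)
    _ = |B| * N * (y * ρ' / ρ) ^ k := by
        rw [div_pow, div_pow, mul_pow]; ring

variable (h : IsFuchsian V S A v) (hV : IsOpen V) (h0 : (0 : ℂ) ∈ V) (hS : IsOpen S)
  (hdisc : ∀ z ∈ V, ∃ ρ, ‖z‖ < ρ ∧ Metric.closedBall 0 ρ ⊆ V)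

/-- Condition `hdisc` says that V is exhausted by discs about 0, so the power series reaches every
point of V. A majorant uniform in both variables yields continuity and holomorphy of its sum. -/
lemma exists_local_bound (h : IsFuchsian V S A v) (hS : IsOpen S)
    (hdisc : ∀ z ∈ V, ∃ ρ, ‖z‖ < ρ ∧ Metric.closedBall 0 ρ ⊆ V) {z₀ w₀ : ℂ} (hz₀ : z₀ ∈ V)
    (hw₀ : w₀ ∈ S) :
    ∃ (ρ ε : ℝ) (u : ℕ → ℝ), ‖z₀‖ < ρ ∧ 0 < ε ∧ Metric.ball 0 ρ ⊆ V ∧ Metric.ball w₀ ε ⊆ S ∧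
      Summable u ∧ ∀ (k : ℕ), ∀ z ∈ Metric.ball (0 : ℂ) ρ, ∀ w ∈ Metric.ball w₀ ε,
        ‖z ^ k • fuchsianCoeff A v k w‖ ≤ u k := by
  obtain ⟨ρ, hρ, hρV⟩ := hdisc z₀ hz₀
  obtain ⟨ρ', h1, h2⟩ := exists_between hρ
  obtain ⟨ε, hε, hεS⟩ := Metric.nhds_basis_closedBall.mem_iff.1 (hS.mem_nhds hw₀)
  obtain ⟨u, hu, hb⟩ := h.exists_summable_bound (isCompact_closedBall w₀ ε) hεS
    ((norm_nonneg _).trans_lt h1) h2 hρV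
  exact ⟨ρ', ε, u, h1, hε, (Metric.ball_subset_closedBall.trans
    (Metric.closedBall_subset_closedBall h2.le)).trans hρV,
    Metric.ball_subset_closedBall.trans hεS, hu, fun k z hz w hw =>
      hb k z (Metric.ball_subset_closedBall hz) w (Metric.ball_subset_closedBall hw)⟩

include h hV h0 hS hdisc

lemma continuousOn_solution :
    ContinuousOn (fun p : ℂ × ℂ => fuchsianSolution A v p.1 p.2) (V ×ˢ S) := by
  rintro ⟨z₀, w₀⟩ ⟨hz₀, hw₀⟩
  obtain ⟨ρ, ε, u, hρ, hε, -, hεS, hu, hb⟩ := h.exists_local_bound hS hdisc hz₀ hw₀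
  have h1 := continuousOn_tsum (f := fun k (p : ℂ × ℂ) => p.1 ^ k • fuchsianCoeff A v k p.2)
    (s := Metric.ball 0 ρ ×ˢ Metric.ball w₀ ε)
    (fun k => ((continuous_fst.pow k).continuousOn).smul
      (((h.differentiableOn_coeff hV h0 hS k).continuousOn.mono hεS).comp
        continuous_snd.continuousOn fun p hp => hp.2)) hu
    fun k p hp => hb k p.1 hp.1 p.2 hp.2
  refine (h1.continuousAt ?_).continuousWithinAt
  exact prod_mem_nhds (Metric.isOpen_ball.mem_nhds (by simpa using hρ)) (Metric.ball_mem_nhds _ hε)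

lemma differentiableOn_solution_right {z : ℂ} (hz : z ∈ V) :
    DifferentiableOn ℂ (fuchsianSolution A v z) S := by
  intro w₀ hw₀
  obtain ⟨ρ, ε, u, hρ, hε, -, hεS, hu, hb⟩ := h.exists_local_bound hS hdisc hz hw₀
  have h1 := Complex.differentiableOn_tsum_of_summable_norm (U := Metric.ball w₀ ε) hu
    (F := fun k w => z ^ k • fuchsianCoeff A v k w)
    (fun k => ((h.differentiableOn_coeff hV h0 hS k).mono hεS).const_smul (z ^ k)) Metric.isOpen_ball
    fun k w hw => hb k z (by simpa using hρ) w hw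
  exact (h1.differentiableAt (Metric.ball_mem_nhds _ hε)).differentiableWithinAt

omit hV h0 in
lemma differentiableOn_solution_left {w : ℂ} (hw : w ∈ S) :
    DifferentiableOn ℂ (fun z => fuchsianSolution A v z w) V := by
  intro z₀ hz₀
  obtain ⟨ρ, ε, u, hρ, hε, -, -, hu, hb⟩ := h.exists_local_bound hS hdisc hz₀ hw
  have h1 := Complex.differentiableOn_tsum_of_summable_norm (U := Metric.ball 0 ρ) hu
    (F := fun k z => z ^ k • fuchsianCoeff A v k w)
    (fun k => ((differentiable_id.pow k).differentiableOn).smul_const _) Metric.isOpen_ball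
    fun k z hz => hb k z hz w (Metric.mem_ball_self hε)
  exact (h1.differentiableAt (Metric.isOpen_ball.mem_nhds (by simpa using hρ))).differentiableWithinAt

omit hV h0 in
lemma smul_deriv_solution {z w : ℂ} (hz : z ∈ V) (hw : w ∈ S) :
    z • deriv (fun z => fuchsianSolution A v z w) z = A z w (fuchsianSolution A v z w) := by
  obtain ⟨ρ, ε, u, hρ, hε, hρV, -, hu, hb⟩ := h.exists_local_bound hS hdisc hz hw
  have hzρ : z ∈ Metric.ball (0 : ℂ) ρ := by simpa using hρ
  have hder := Complex.hasSum_deriv_of_summable_norm (U := Metric.ball 0 ρ) hu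
    (F := fun k z => z ^ k • fuchsianCoeff A v k w)
    (fun k => ((differentiable_id.pow k).differentiableOn).smul_const _) Metric.isOpen_ball
    (fun k z hz => hb k z hz w (Metric.mem_ball_self hε)) hzρ
  have hbz := fun k => hb k z hzρ w (Metric.mem_ball_self hε)
  have hsum : Summable fun k => ‖z ^ k • fuchsianCoeff A v k w‖ :=
    Summable.of_nonneg_of_le (fun _ => norm_nonneg _) hbz hu
  obtain ⟨s, hs1, hs2⟩ := exists_between hρ
  have hs0 : 0 < s := (norm_nonneg z).trans_lt hs1
  have hAs : DifferentiableOn ℂ (fun z => A z w) (Metric.closedBall 0 s) :=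
    (h.diff_left w hw).mono ((Metric.closedBall_subset_ball hs2).trans hρV)
  obtain ⟨M, hM⟩ := (isCompact_sphere (0 : ℂ) s).exists_bound_of_continuousOn
    (hAs.continuousOn.mono Metric.sphere_subset_closedBall)
  have hA := hasSum_taylorCoeff (hAs.mono Metric.ball_subset_closedBall) hs1
  have hAn : Summable fun j => ‖z ^ j • taylorCoeff j fun z => A z w‖ := by
    have hlt : ‖z‖ / s < 1 := (div_lt_one hs0).2 hs1
    refine Summable.of_nonneg_of_le (fun _ => norm_nonneg _) (fun j => ?_)
      ((summable_geometric_of_lt_one (by positivity) hlt).mul_left M)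
    rw [norm_smul, norm_pow]
    refine (mul_le_mul_of_nonneg_left (norm_taylorCoeff_le hs0 hAs hM j) (by positivity)).trans_eq ?_
    rw [div_pow]; ring
  -- Applying z d/dz multiplies the k-th coefficient by k, and the Cauchy product of A with the
  -- solution produces the other side of the Frobenius recursion.
  have hprod := hasSum_clm_apply z hA hsum.of_norm.hasSum hAn hsum
  refine (hder.const_smul z).unique (hprod.congr_fun fun k => ?_)
  have h1 : deriv (fun z => z ^ k • fuchsianCoeff A v k w) z =
      (k * z ^ (k - 1)) • fuchsianCoeff A v k w :=
    ((hasDerivAt_pow k z).smul_const _).deriv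
  have h2 : (k : ℂ) • fuchsianCoeff A v k w = _ :=
    smul_frobeniusCoeff (a := fun j => taylorCoeff j fun z => A z w) (v := v w)
      (by rw [taylorCoeff_zero]; exact h.initial w hw) (h.nonresonant_taylor hw) k
  change z • deriv (fun z => z ^ k • fuchsianCoeff A v k w) z = _
  rw [h1]
  change _ = z ^ k • ∑ i ∈ Finset.range (k + 1), (taylorCoeff (k - i) fun z => A z w)
    (frobeniusCoeff (fun j => taylorCoeff j fun z => A z w) (v w) i)
  rw [← h2, smul_smul, smul_smul]
  congr 1
  rcases k with _ | k
  · simp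
  · rw [Nat.add_sub_cancel, pow_succ]; ring

end IsFuchsian

/-- A holomorphic solution of a nonresonant Fuchsian system that vanishes at `0` is zero. -/
lemma eqOn_zero_of_fuchsian {V : Set ℂ} (hV : IsOpen V) (hVc : IsPreconnected V)
    (h0 : (0 : ℂ) ∈ V) {B : ℂ → E →L[ℂ] E} (hB : ContinuousAt B 0)
    (hu : ∀ k : ℕ, 1 ≤ k → IsUnit ((k : ℂ) • (1 : E →L[ℂ] E) - B 0)) {Q : ℂ → E}
    (hQ : DifferentiableOn ℂ Q V) (hQ0 : Q 0 = 0) (hode : ∀ z ∈ V, z • deriv Q z = B z (Q z)) :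
    EqOn Q 0 V := by
  have han : AnalyticAt ℂ Q 0 := hQ.analyticAt (hV.mem_nhds h0)
  by_cases hz : ∀ᶠ z in 𝓝 0, Q z = 0
  · exact AnalyticOnNhd.eqOn_of_preconnected_of_eventuallyEq
      (fun x hx => hQ.analyticAt (hV.mem_nhds hx)) (fun x _ => analyticAt_const) hVc h0 hz
  exfalso
  -- The leading coefficient g 0 would be an eigenvector: dividing the equation by z^n and letting z
  -- tend to 0 gives n g(0) = B(0) g(0), with n ≥ 1 because Q vanishes at 0.
  obtain ⟨n, g, hg, hg0, hQg⟩ := han.exists_eventuallyEq_pow_smul_nonzero_iff.2 hz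
  simp only [sub_zero] at hQg
  have hn : 1 ≤ n := by
    rcases Nat.eq_zero_or_pos n with rfl | hn
    · have := hQg.self_of_nhds
      rw [hQ0] at this
      exact absurd this.symm (by simpa using hg0)
    · exact hn
  have hkey : ∀ᶠ z in 𝓝[≠] (0 : ℂ), (n : ℂ) • g z + z • deriv g z = B z (g z) := by
    filter_upwards [nhdsWithin_le_nhds hQg.eventually_nhds,
      nhdsWithin_le_nhds hg.eventually_analyticAt, nhdsWithin_le_nhds (hV.mem_nhds h0),
      self_mem_nhdsWithin] with z hz1 hz2 hz3 hz4
    have hd : deriv Q z = z ^ n • deriv g z + (n * z ^ (n - 1)) • g z := by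
      rw [Filter.EventuallyEq.deriv_eq hz1]
      exact ((hasDerivAt_pow n z).smul hz2.differentiableAt.hasDerivAt).deriv
    have h1 := hode z hz3
    rw [hd, hz1.self_of_nhds, map_smul] at h1
    have h2 : z ^ n • ((n : ℂ) • g z + z • deriv g z) = z ^ n • B z (g z) := by
      rw [← h1, smul_add, smul_add, add_comm]
      simp only [smul_smul]
      congr 2
      · ring
      · obtain ⟨m, rfl⟩ := Nat.exists_eq_add_of_le' hn
        rw [Nat.add_sub_cancel, pow_succ]; ring
    exact smul_right_injective E (pow_ne_zero n hz4) h2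
  have hl : Tendsto (fun z => (n : ℂ) • g z + z • deriv g z) (𝓝[≠] 0) (𝓝 ((n : ℂ) • g 0)) := by
    have hcont : ContinuousAt (fun z => (n : ℂ) • g z + z • deriv g z) 0 :=
      (hg.continuousAt.const_smul _).add (continuousAt_id.smul hg.deriv.continuousAt)
    have := hcont.tendsto.mono_left (nhdsWithin_le_nhds (s := {0}ᶜ))
    simpa using this
  have hr : Tendsto (fun z => B z (g z)) (𝓝[≠] 0) (𝓝 (B 0 (g 0))) :=
    (hB.clm_apply hg.continuousAt).tendsto.mono_left nhdsWithin_le_nhds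
  have heq := tendsto_nhds_unique (hl.congr' hkey) hr
  have h3 := congrArg (fun T : E →L[ℂ] E => T (g 0)) (Ring.inverse_mul_cancel _ (hu n hn))
  refine hg0 ?_
  simpa [heq] using h3.symm

end Fuchsian

/-! ### The eigenvalues of the Delaunay residue -/

/-- The square of the eigenvalues of the Delaunay residue. -/
noncomputable def delaunayEigSq (α β : ℝ) (w : ℂ) : ℂ := ((α : ℂ) * w⁻¹ + β * w) * (β * w⁻¹ + α * w)

lemma delaunay_mul_self (α β : ℝ) (w : ℂ) :
    delaunay α β w * delaunay α β w = delaunayEigSq α β w • (1 : Mat) := by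
  ext i j
  fin_cases i <;> fin_cases j <;>
    simp [delaunay, delaunayEigSq, Matrix.mul_apply, Fin.sum_univ_two, mul_comm]

/-- If `z + z⁻¹` is real and `|z| < 1`, then `z` is real. -/
lemma abs_eq_of_add_inv_eq {z : ℂ} {t : ℝ} (h0 : z ≠ 0) (h1 : ‖z‖ < 1) (h : z + z⁻¹ = t) :
    |t| = ‖z‖ + ‖z‖⁻¹ := by
  have hn : 0 < ‖z‖ := norm_pos_iff.2 h0
  have hsq : 0 < Complex.normSq z := Complex.normSq_pos.2 h0
  have hsq1 : Complex.normSq z < 1 := by rw [Complex.normSq_eq_norm_sq]; nlinarith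
  have him : z.im = 0 := by
    have h2 := congrArg Complex.im h
    rw [Complex.add_im, Complex.inv_im, Complex.ofReal_im] at h2
    have h3 : z.im * (Complex.normSq z - 1) = 0 := by
      field_simp at h2
      linear_combination h2
    rcases mul_eq_zero.1 h3 with h4 | h4
    · exact h4
    · linarith
  obtain ⟨x, rfl⟩ : ∃ x : ℝ, z = x := ⟨z.re, Complex.ext rfl (by simpa using him)⟩
  have hx : x ≠ 0 := by exact_mod_cast h0
  have h4 : t = x + x⁻¹ := by exact_mod_cast h.symm
  rw [Complex.norm_real, Real.norm_eq_abs, h4, ← abs_inv]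
  rcases lt_or_gt_of_ne hx with hx | hx
  · rw [abs_of_neg hx, abs_of_neg (inv_lt_zero.2 hx), abs_of_neg (add_neg hx (inv_lt_zero.2 hx))]
    ring
  · rw [abs_of_pos hx, abs_of_pos (inv_pos.2 hx), abs_of_pos (add_pos hx (inv_pos.2 hx))]

lemma exists_add_inv_eq {τ : ℝ} (hτ : 2 < τ) : ∃ x : ℝ, 0 < x ∧ x < 1 ∧ x + x⁻¹ = τ := by
  set d := Real.sqrt (τ ^ 2 - 4) with hd
  have hd2 : d ^ 2 = τ ^ 2 - 4 := Real.sq_sqrt (by nlinarith)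
  have hd0 : 0 ≤ d := Real.sqrt_nonneg _
  have hdτ : d < τ := by nlinarith
  have hd1 : τ - 2 < d := by nlinarith
  refine ⟨(τ - d) / 2, by linarith, by linarith, ?_⟩
  have : τ - d ≠ 0 := by linarith
  field_simp
  nlinarith

/-- There is an annulus inside the unit disc on which the Delaunay residue is nonresonant. -/
lemma exists_nonresonant_annulus {α β : ℝ} (hα : α ≠ 0) (hβ : β ≠ 0) :
    ∃ r₁ r r₂ : ℝ, 0 ≤ r₁ ∧ r₁ < r ∧ r < r₂ ∧ r < 1 ∧ ∀ w ∈ annulus r₁ r₂, ∀ k : ℕ,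
      (k : ℂ) ^ 2 ≠ 4 * delaunayEigSq α β w := by
  -- These constants come from 4μ² = 4αβ(w² + w⁻²) + δ.
  set γ := |4 * (α * β)| with hγ
  set δ := 4 * (α ^ 2 + β ^ 2) with hδ
  have hγ0 : 0 < γ := abs_pos.2 (by positivity)
  have hδ0 : 0 < δ := by positivity
  -- A large m gives τ > 2, so that x + x⁻¹ = τ has a root in (0, 1), and also m² − δ > δ, which
  -- excludes the case k² < δ at the end.
  obtain ⟨m, hm⟩ := exists_nat_gt (2 * δ + 2 * γ + 1)
  have hm1 : (1 : ℝ) ≤ m := by linarith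
  -- The value m² + m lies strictly between consecutive squares, so γ(ρ² + ρ⁻²) + δ cannot be a
  -- square at ρ = √x, nor, by continuity, on a thin annulus.
  set τ := ((m : ℝ) ^ 2 + m - δ) / γ with hτ
  have hτγ : γ * τ = (m : ℝ) ^ 2 + m - δ := by rw [hτ]; field_simp
  have hτ2 : 2 < τ := by
    rw [hτ, lt_div_iff₀ hγ0]; nlinarith
  obtain ⟨x, hx0, hx1, hx⟩ := exists_add_inv_eq hτ2
  have hr0 : 0 < Real.sqrt x := Real.sqrt_pos.2 hx0
  have hcont : ContinuousAt (fun ρ : ℝ => γ * (ρ ^ 2 + (ρ ^ 2)⁻¹)) (Real.sqrt x) := by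
    have : Real.sqrt x ^ 2 ≠ 0 := by positivity
    fun_prop (disch := exact this)
  have hval : γ * (Real.sqrt x ^ 2 + (Real.sqrt x ^ 2)⁻¹) = (m : ℝ) ^ 2 + m - δ := by
    rw [Real.sq_sqrt hx0.le, hx, hτγ]
  have hr1 : Real.sqrt x < 1 := by
    rw [Real.sqrt_lt' one_pos]; simpa using hx1
  have hev : ∀ᶠ ρ in 𝓝 (Real.sqrt x), 0 < ρ ∧ ρ < 1 ∧
      γ * (ρ ^ 2 + (ρ ^ 2)⁻¹) ∈ Ioo ((m : ℝ) ^ 2 - δ) (((m : ℝ) + 1) ^ 2 - δ) := by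
    refine (lt_mem_nhds hr0).and ((gt_mem_nhds hr1).and (hcont.preimage_mem_nhds ?_))
    rw [hval]
    exact Ioo_mem_nhds (by linarith) (by nlinarith)
  obtain ⟨r₁, r₂, hrI, hI⟩ := mem_nhds_iff_exists_Ioo_subset.1 hev
  refine ⟨max r₁ 0, Real.sqrt x, r₂, le_max_right _ _, max_lt hrI.1 hr0, hrI.2, hr1, ?_⟩
  intro w hw k hk
  obtain ⟨hw0, hw1, hw2⟩ := hI ⟨(le_max_left _ _).trans_lt hw.1, hw.2⟩
  have hwne : w ≠ 0 := norm_pos_iff.1 hw0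
  have hab : (4 * (α * β) : ℝ) ≠ 0 := by positivity
  have habc : ((4 * (α * β) : ℝ) : ℂ) ≠ 0 := by exact_mod_cast hab
  have h1 : w ^ 2 + (w ^ 2)⁻¹ = (((k : ℝ) ^ 2 - δ) / (4 * (α * β)) : ℝ) := by
    have h2 : ((4 * (α * β) : ℝ) : ℂ) * (w ^ 2 + (w ^ 2)⁻¹) = (k : ℂ) ^ 2 - (δ : ℂ) := by
      rw [hk, delaunayEigSq, hδ]
      push_cast
      field_simp
      ring
    rw [Complex.ofReal_div, eq_div_iff habc, mul_comm, h2]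
    push_cast
    ring
  have h3 := abs_eq_of_add_inv_eq (pow_ne_zero 2 hwne)
    (by rw [norm_pow]; exact pow_lt_one₀ hw0.le hw1 two_ne_zero) h1
  rw [norm_pow, abs_div, div_eq_iff (abs_pos.2 hab).ne', ← hγ, mul_comm] at h3
  rw [← h3] at hw2
  rcases abs_cases ((k : ℝ) ^ 2 - δ) with ⟨h4, -⟩ | ⟨h4, -⟩
  · rw [h4] at hw2
    have h5 : (m : ℝ) ^ 2 < (k : ℝ) ^ 2 := by linarith [hw2.1]
    have h6 : (k : ℝ) ^ 2 < ((m : ℝ) + 1) ^ 2 := by linarith [hw2.2]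
    have h7 : m < k := by exact_mod_cast lt_of_pow_lt_pow_left₀ 2 (by positivity) h5
    have h8 : (k : ℝ) < (m : ℝ) + 1 := lt_of_pow_lt_pow_left₀ 2 (by positivity) h6
    have h9 : k < m + 1 := by exact_mod_cast h8
    omega
  · rw [h4] at hw2
    nlinarith [hw2.1, sq_nonneg (k : ℝ)]

/-! ### Matrix calculus -/

open scoped Matrix.Norms.Operator

lemma Mat.eq_sum (X : Mat) : X = ∑ i, ∑ j, X i j • Matrix.single i j (1 : ℂ) := by
  conv_lhs => rw [Matrix.matrix_eq_sum_single X]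
  simp [Matrix.smul_single]

lemma differentiableOn_mat {F : Type*} [NormedAddCommGroup F] [NormedSpace ℂ F] {f : F → Mat}
    {s : Set F} : DifferentiableOn ℂ f s ↔ ∀ i j, DifferentiableOn ℂ (fun x => f x i j) s := by
  constructor
  · intro h i j
    exact (Matrix.entryLinearMap ℂ ℂ i j : Mat →ₗ[ℂ] ℂ).toContinuousLinearMap.differentiable.comp_differentiableOn h
  · intro h
    have : f = fun x => ∑ i, ∑ j, f x i j • Matrix.single i j (1 : ℂ) := funext fun x => Mat.eq_sum _
    rw [this]
    exact DifferentiableOn.fun_sum fun i _ => DifferentiableOn.fun_sum fun j _ =>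
      (h i j).smul_const _

lemma hasDerivAt_mat {f : ℂ → Mat} {f' : Mat} {x : ℂ} (h : HasDerivAt f f' x) (i j : Fin 2) :
    HasDerivAt (fun x => f x i j) (f' i j) x :=
  (Matrix.entryLinearMap ℂ ℂ i j : Mat →ₗ[ℂ] ℂ).toContinuousLinearMap.hasFDerivAt.comp_hasDerivAt x h

/-- The relation L³ = 4c L confines the spectrum to 0 and ±2√c. For other k, the inverse of k − L is
an explicit quadratic polynomial in L, so no finite-dimensionality is required. -/
lemma isUnit_of_cube_eq {R : Type*} [Ring R] [Algebra ℂ R] {L : R} {c k : ℂ}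
    (hL : L * L * L = (4 * c) • L) (hk : k ≠ 0) (hkc : k ^ 2 ≠ 4 * c) :
    IsUnit (k • (1 : R) - L) := by
  have hN : k ^ 2 - 4 * c ≠ 0 := sub_ne_zero.2 hkc
  have hkN : k * (k ^ 2 - 4 * c) ≠ 0 := mul_ne_zero hk hN
  set M : R := (k * (k ^ 2 - 4 * c))⁻¹ • ((k ^ 2 - 4 * c) • (1 : R) + k • L + L * L) with hM
  have hL' : L * (L * L) = (4 * c) • L := by rw [← mul_assoc, hL]
  have e1 : (k • (1 : R) - L) * ((k ^ 2 - 4 * c) • (1 : R) + k • L + L * L) =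
      (k * (k ^ 2 - 4 * c)) • (1 : R) := by
    simp only [sub_mul, mul_add, smul_mul_assoc, mul_smul_comm, one_mul, mul_one, hL']
    module
  have e2 : ((k ^ 2 - 4 * c) • (1 : R) + k • L + L * L) * (k • (1 : R) - L) =
      (k * (k ^ 2 - 4 * c)) • (1 : R) := by
    simp only [mul_sub, add_mul, smul_mul_assoc, mul_smul_comm, one_mul, mul_one, hL]
    module
  refine isUnit_iff_exists.2 ⟨M, ?_, ?_⟩
  · rw [hM, mul_smul_comm, e1, smul_smul, inv_mul_cancel₀ hkN, one_smul]
  · rw [hM, smul_mul_assoc, e2, smul_smul, inv_mul_cancel₀ hkN, one_smul]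

section Algebra

variable {R : Type*} [NormedRing R] [NormedAlgebra ℂ R]

/-- Right multiplication. -/
noncomputable def rmul : R →L[ℂ] R →L[ℂ] R := (ContinuousLinearMap.mul ℂ R).flip

/-- The commutator `X ↦ X D - D X`. -/
noncomputable def commutator : R →L[ℂ] R →L[ℂ] R := rmul - ContinuousLinearMap.mul ℂ R

lemma rmul_apply (B X : R) : rmul B X = X * B := rfl

lemma commutator_apply (D X : R) : commutator D X = X * D - D * X := rfl

/-- Left and right multiplication by D commute and both square to c; the cube of their difference
expands to 4c times the difference. -/
lemma commutator_cube {D : R} {c : ℂ} (hD : D * D = c • (1 : R)) :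
    commutator D * commutator D * commutator D = (4 * c) • commutator D := by
  ext1 X
  change commutator D (commutator D (commutator D X)) = (4 * c) • commutator D X
  have h1 : ∀ Y : R, Y * D * D = c • Y := fun Y => by rw [mul_assoc, hD]; simp
  have h2 : ∀ Y : R, D * (D * Y) = c • Y := fun Y => by rw [← mul_assoc, hD]; simp
  have h3 : D * (X * D) = D * X * D := (mul_assoc _ _ _).symm
  simp only [commutator_apply, sub_mul, mul_sub, h1, h2, mul_smul_comm, smul_mul_assoc, h3]
  have h4 : D * (D * X * D) = c • (X * D) := by rw [← h3, h2]
  rw [h4]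
  module

lemma isUnit_sub_commutator {D : R} {c : ℂ} (hD : D * D = c • (1 : R)) {k : ℕ} (hk : 1 ≤ k)
    (h : (k : ℂ) ^ 2 ≠ 4 * c) : IsUnit ((k : ℂ) • (1 : R →L[ℂ] R) - commutator D) :=
  isUnit_of_cube_eq (commutator_cube hD) (by exact_mod_cast (Nat.one_le_iff_ne_zero.1 hk)) h

end Algebra

lemma sigma3_mul_self : sigma3 * sigma3 = 1 := by
  ext i j
  fin_cases i <;> fin_cases j <;> simp [sigma3, Matrix.mul_apply, Fin.sum_univ_two]

lemma sigma3_inv : sigma3⁻¹ = sigma3 := Matrix.inv_eq_right_inv sigma3_mul_self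

lemma isUnit_sigma3 : IsUnit sigma3 := IsUnit.of_mul_eq_one _ sigma3_mul_self

lemma twist_delaunay (α β : ℝ) (w : ℂ) : twist (delaunay α β) w = delaunay α β w := by
  rw [twist, sigma3_inv]
  ext i j
  fin_cases i <;> fin_cases j <;>
    simp [sigma3, delaunay, Matrix.mul_apply, Fin.sum_univ_two] <;> ring

lemma trace_delaunay (α β : ℝ) (w : ℂ) : (delaunay α β w).trace = 0 := by
  simp [delaunay, Matrix.trace_fin_two]

lemma differentiableOn_delaunay (α β : ℝ) : DifferentiableOn ℂ (delaunay α β) {0}ᶜ := by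
  have h1 : DifferentiableOn ℂ (fun w : ℂ => w⁻¹) {0}ᶜ := differentiableOn_id.inv fun w hw => hw
  rw [differentiableOn_mat]
  intro i j
  fin_cases i <;> fin_cases j
  · exact differentiableOn_const 0
  · exact (h1.const_mul (α : ℂ)).add (differentiableOn_id.const_mul (β : ℂ))
  · exact (h1.const_mul (β : ℂ)).add (differentiableOn_id.const_mul (α : ℂ))
  · exact differentiableOn_const 0

/-! ### The gauge that brings a potential with a simple pole to its residue -/

section Gauge

variable {R : Type*} [NormedRing R] [NormedAlgebra ℂ R] [CompleteSpace R]

/-- The Fuchsian system for the gauge, in a uniformizing coordinate. -/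
noncomputable def gaugeSystem (φ : ℂ → ℂ) (η : ℂ → ℂ → R) (D : ℂ → R) (z w : ℂ) : R →L[ℂ] R :=
  (z * deriv φ z) • rmul (η (φ z) w) + (deriv φ z / dslope φ 0 z) • commutator (D w)

/-- Substituting z = φ(ζ) multiplies the residue term by ζφ'/φ, written with `dslope φ 0` = φ/ζ.
This factor is holomorphic with value 1 at 0, so the operator at the singular point is still the
commutator with D. The uniqueness clause serves to derive the twisting symmetry. -/
theorem exists_gauge {U S : Set ℂ} (hU : IsOpen U) (hUs : IsSimplyConnected U) (h0 : (0 : ℂ) ∈ U)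
    (hS : IsOpen S) {η : ℂ → ℂ → R} {D : ℂ → R}
    (hηc : ContinuousOn (fun p : ℂ × ℂ => η p.1 p.2) (U ×ˢ S))
    (hη₁ : ∀ w ∈ S, DifferentiableOn ℂ (fun z => η z w) U)
    (hη₂ : ∀ z ∈ U, DifferentiableOn ℂ (η z) S)
    (hD : DifferentiableOn ℂ D S)
    (hnr : ∀ w ∈ S, ∃ c : ℂ, D w * D w = c • (1 : R) ∧ ∀ k : ℕ, 1 ≤ k → (k : ℂ) ^ 2 ≠ 4 * c) :
    ∃ P : ℂ → ℂ → R, ContinuousOn (fun p : ℂ × ℂ => P p.1 p.2) (U ×ˢ S) ∧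
      (∀ w ∈ S, DifferentiableOn ℂ (fun z => P z w) U) ∧
      (∀ z ∈ U, DifferentiableOn ℂ (P z) S) ∧
      (∀ w ∈ S, P 0 w = 1) ∧
      (∀ w ∈ S, ∀ z ∈ U, z • deriv (fun z => P z w) z =
        z • (P z w * η z w) + (P z w * D w - D w * P z w)) ∧
      ∀ w ∈ S, ∀ Q : ℂ → R, DifferentiableOn ℂ Q U → Q 0 = 1 →
        (∀ z ∈ U, z • deriv Q z = z • (Q z * η z w) + (Q z * D w - D w * Q z)) →
        ∀ z ∈ U, Q z = P z w := by
  obtain ⟨V, φ, ψ, hV', hφ, hψ, hφm, hψm, hφψ, hψφ, hφ0, hψ0⟩ := exists_uniformization hU hUs h0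
  have hV : IsOpen V := by
    rcases hV' with rfl | rfl
    exacts [isOpen_univ, Metric.isOpen_ball]
  have hVc : IsPreconnected V := by
    rcases hV' with rfl | rfl
    exacts [isPreconnected_univ, (convex_ball _ _).isPreconnected]
  have h0V : (0 : ℂ) ∈ V := by
    rcases hV' with rfl | rfl
    exacts [mem_univ _, Metric.mem_ball_self one_pos]
  have hdisc : ∀ z ∈ V, ∃ ρ, ‖z‖ < ρ ∧ Metric.closedBall 0 ρ ⊆ V := by
    rcases hV' with rfl | rfl
    · exact fun z _ => ⟨‖z‖ + 1, lt_add_one _, subset_univ _⟩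
    · intro z hz
      obtain ⟨ρ, h1, h2⟩ := exists_between (mem_ball_zero_iff.1 hz)
      exact ⟨ρ, h1, Metric.closedBall_subset_ball h2⟩
  have hφd : ∀ z ∈ V, HasDerivAt φ (deriv φ z) z := fun z hz =>
    (hφ.differentiableAt (hV.mem_nhds hz)).hasDerivAt
  have hψd : ∀ z ∈ U, HasDerivAt ψ (deriv ψ z) z := fun z hz =>
    (hψ.differentiableAt (hU.mem_nhds hz)).hasDerivAt
  have hdd : ∀ z ∈ V, deriv ψ (φ z) * deriv φ z = 1 := fun z hz => by
    have h1 := (hψd (φ z) (hφm hz)).comp z (hφd z hz)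
    have h2 : HasDerivAt (fun z => z) (deriv ψ (φ z) * deriv φ z) z := by
      refine h1.congr_of_eventuallyEq ?_
      filter_upwards [hV.mem_nhds hz] with x hx using (hψφ x hx).symm
    exact h2.unique (hasDerivAt_id z)
  have hslope : DifferentiableOn ℂ (dslope φ 0) V :=
    (Complex.differentiableOn_dslope (hV.mem_nhds h0V)).2 hφ
  have hzs : ∀ z, z * dslope φ 0 z = φ z := fun z => by
    have := sub_smul_dslope φ 0 z
    simpa [hφ0] using this
  have hslope0 : ∀ z ∈ V, dslope φ 0 z ≠ 0 := fun z hz h => by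
    by_cases hz0 : z = 0
    · rw [hz0, dslope_same] at h
      have := hdd 0 h0V
      simp [h] at this
    · have h1 := hzs z
      rw [h, mul_zero] at h1
      have h2 := hψφ z hz
      rw [← h1, hψ0] at h2
      exact hz0 h2.symm
  have hφ' : DifferentiableOn ℂ (deriv φ) V := hφ.deriv hV
  have hu : DifferentiableOn ℂ (fun z => deriv φ z / dslope φ 0 z) V := hφ'.div hslope hslope0
  have hsys0 : ∀ w, gaugeSystem φ η D 0 w = commutator (D w) := fun w => by
    have h1 : deriv φ 0 ≠ 0 := fun h => by
      have := hdd 0 h0V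
      simp [h] at this
    ext1 X
    simp [gaugeSystem, dslope_same, div_self h1]
  have hF : IsFuchsian V S (gaugeSystem φ η D) (fun _ => (1 : R)) := by
    refine ⟨?_, fun w hw => ?_, fun z hz => ?_, fun w hw k hk => ?_, differentiableOn_const _,
      fun w _ => ?_⟩
    · have e1 : ContinuousOn (fun p : ℂ × ℂ => p.1 * deriv φ p.1) (V ×ˢ S) :=
        continuousOn_fst.mul (hφ'.continuousOn.comp continuousOn_fst fun p hp => hp.1)
      have e2 : ContinuousOn (fun p : ℂ × ℂ => deriv φ p.1 / dslope φ 0 p.1) (V ×ˢ S) :=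
        hu.continuousOn.comp continuousOn_fst fun p hp => hp.1
      have e3 : ContinuousOn (fun p : ℂ × ℂ => η (φ p.1) p.2) (V ×ˢ S) :=
        hηc.comp ((hφ.continuousOn.comp continuousOn_fst fun p hp => hp.1).prodMk continuousOn_snd)
          fun p hp => ⟨hφm hp.1, hp.2⟩
      have e4 : ContinuousOn (fun p : ℂ × ℂ => D p.2) (V ×ˢ S) :=
        hD.continuousOn.comp continuousOn_snd fun p hp => hp.2
      exact (e1.smul ((rmul (R := R)).continuous.comp_continuousOn e3)).add
        (e2.smul ((commutator (R := R)).continuous.comp_continuousOn e4))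
    · have e3 : DifferentiableOn ℂ (fun z => η (φ z) w) V := (hη₁ w hw).comp hφ hφm
      exact ((differentiableOn_id.mul hφ').smul
        ((rmul (R := R)).differentiable.comp_differentiableOn e3)).add (hu.smul_const _)
    · exact (((rmul (R := R)).differentiable.comp_differentiableOn (hη₂ _ (hφm hz))).const_smul
        (z * deriv φ z)).add
        (((commutator (R := R)).differentiable.comp_differentiableOn hD).const_smul
          (deriv φ z / dslope φ 0 z))
    · rw [hsys0]
      obtain ⟨c, hc, hck⟩ := hnr w hw
      exact isUnit_sub_commutator hc hk (hck k hk)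
    · rw [hsys0, commutator_apply]; simp
  have hP₁ : ∀ w ∈ S, DifferentiableOn ℂ (fun z => fuchsianSolution (gaugeSystem φ η D)
      (fun _ => 1) (ψ z) w) U := fun w hw =>
    (hF.differentiableOn_solution_left hS hdisc hw).comp hψ hψm
  have hode : ∀ w ∈ S, ∀ z ∈ U, z • deriv (fun z => fuchsianSolution (gaugeSystem φ η D)
        (fun _ => 1) (ψ z) w) z =
      z • (fuchsianSolution (gaugeSystem φ η D) (fun _ => 1) (ψ z) w * η z w) +
      (fuchsianSolution (gaugeSystem φ η D) (fun _ => 1) (ψ z) w * D w -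
        D w * fuchsianSolution (gaugeSystem φ η D) (fun _ => 1) (ψ z) w) := by
    intro w hw z hz
    have hζ := hψm hz
    have h1 := hF.smul_deriv_solution hS hdisc hζ hw
    have h2 := ((hF.differentiableOn_solution_left hS hdisc hw).differentiableAt
      (hV.mem_nhds hζ)).hasDerivAt.scomp z (hψd z hz)
    have h3 := h2.deriv
    have h4 := hdd (ψ z) hζ
    have h5 := hzs (ψ z)
    rw [hφψ z hz] at h4 h5
    rw [show (fun z => fuchsianSolution (gaugeSystem φ η D) (fun _ => 1) (ψ z) w) =
      (fun z => fuchsianSolution (gaugeSystem φ η D) (fun _ => 1) z w) ∘ ψ from rfl, h3]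
    have h6 : z * deriv ψ z = dslope φ 0 (ψ z) * deriv ψ z * ψ z := by
      linear_combination (-(deriv ψ z)) * h5
    rw [smul_smul, h6, mul_smul, h1, gaugeSystem, hφψ z hz]
    simp only [add_apply, smul_apply, rmul_apply, commutator_apply, smul_add, smul_smul]
    congr 2
    · linear_combination (dslope φ 0 (ψ z) * ψ z) * h4 + h5
    · have h7 := hslope0 _ hζ
      rw [show dslope φ 0 (ψ z) * deriv ψ z * (deriv φ (ψ z) / dslope φ 0 (ψ z)) = 1 by
        field_simp; exact h4, one_smul]
  refine ⟨fun z w => fuchsianSolution (gaugeSystem φ η D) (fun _ => 1) (ψ z) w, ?_, hP₁,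
    fun z hz => hF.differentiableOn_solution_right hV h0V hS hdisc (hψm hz),
    fun w _ => by simp only [hψ0, fuchsianSolution_zero], hode, ?_⟩
  · exact (hF.continuousOn_solution hV h0V hS hdisc).comp
      ((hψ.continuousOn.comp continuousOn_fst fun p hp => hp.1).prodMk continuousOn_snd)
      fun p hp => ⟨hψm hp.1, hp.2⟩
  · intro w hw Q hQ hQ0 hQode z hz
    have hQφ : DifferentiableOn ℂ (fun ζ => Q (φ ζ)) V := hQ.comp hφ hφm
    have hkey := eqOn_zero_of_fuchsian hV hVc h0V
      (B := fun z => gaugeSystem φ η D z w)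
      ((hF.diff_left w hw).continuousOn.continuousAt (hV.mem_nhds h0V)) (hF.nonresonant w hw)
      (Q := fun ζ => Q (φ ζ) - fuchsianSolution (gaugeSystem φ η D) (fun _ => 1) ζ w)
      (hQφ.sub (hF.differentiableOn_solution_left hS hdisc hw))
      (by simp [hφ0, hQ0, fuchsianSolution_zero]) (fun ζ hζ => ?_) (hψm hz)
    · simpa [hφψ z hz, sub_eq_zero] using hkey
    · have hd1 := ((hQ.differentiableAt (hU.mem_nhds (hφm hζ))).hasDerivAt.scomp ζ (hφd ζ hζ))
      have hd2 := ((hF.differentiableOn_solution_left hS hdisc hw).differentiableAt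
        (hV.mem_nhds hζ)).hasDerivAt
      have hd3 := (hd1.sub hd2).deriv
      rw [show (fun ζ => Q (φ ζ) - fuchsianSolution (gaugeSystem φ η D) (fun _ => 1) ζ w) =
        (Q ∘ φ) - (fun ζ => fuchsianSolution (gaugeSystem φ η D) (fun _ => 1) ζ w) from rfl, hd3,
        smul_sub, hF.smul_deriv_solution hS hdisc hζ hw]
      change _ = gaugeSystem φ η D ζ w (Q (φ ζ) - _)
      rw [map_sub]
      congr 1
      have h7 := hslope0 ζ hζ
      have h8 := hQode (φ ζ) (hφm hζ)
      have h9 : ζ * deriv φ ζ = deriv φ ζ / dslope φ 0 ζ * φ ζ := by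
        rw [← hzs ζ]; field_simp
      rw [smul_smul, h9, mul_smul, h8, gaugeSystem]
      simp only [add_apply, smul_apply, rmul_apply, commutator_apply, smul_add, smul_smul]
      rw [← h9]

end Gauge

/-! ### Determinants, twisting and uniqueness of frames -/

section Frames

open scoped Matrix.Norms.Operator

lemma hasDerivAt_of_entries {f : ℂ → Mat} {f' : Mat} {x : ℂ}
    (h : ∀ i j, HasDerivAt (fun x => f x i j) (f' i j) x) : HasDerivAt f f' x := by
  have h1 : f = fun x => ∑ i, ∑ j, f x i j • Matrix.single i j (1 : ℂ) :=
    funext fun x => Mat.eq_sum _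
  rw [h1, Mat.eq_sum f']
  exact HasDerivAt.fun_sum fun i _ => HasDerivAt.fun_sum fun j _ => (h i j).smul_const _

/-- Liouville's formula. -/
lemma hasDerivAt_det {X : ℂ → Mat} {B C : Mat} {z : ℂ}
    (h : HasDerivAt X (X z * B + C * X z) z) :
    HasDerivAt (fun z => (X z).det) ((B.trace + C.trace) * (X z).det) z := by
  have e := hasDerivAt_mat h
  simp only [Matrix.det_fin_two]
  convert! ((e 0 0).mul (e 1 1)).sub ((e 0 1).mul (e 1 0)) using 1
  simp only [Matrix.trace_fin_two, Matrix.add_apply, Matrix.mul_apply, Fin.sum_univ_two]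
  ring

/-! ### Holomorphic families of loops -/

lemma isHolomorphicLoopMap_of_differentiableOn (T : LoopTopology) {r₁ r r₂ : ℝ} (h0 : 0 ≤ r₁)
    (h₁ : r₁ < r) (h₂ : r < r₂) {V : Set ℂ} (hV : IsOpen V) {Φ : ℂ → ℂ → Mat}
    (hc : ContinuousOn (fun p : ℂ × ℂ => Φ p.1 p.2) (V ×ˢ annulus r₁ r₂))
    (hl : ∀ w ∈ annulus r₁ r₂, DifferentiableOn ℂ (fun z => Φ z w) V)
    (hr : ∀ z ∈ V, DifferentiableOn ℂ (Φ z) (annulus r₁ r₂))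
    (hdet : ∀ z ∈ V, ∀ w ∈ annulus r₁ r₂, (Φ z w).det = 1)
    (htw : ∀ z ∈ V, ∀ w ∈ annulus r₁ r₂, twist (Φ z) w = Φ z w) :
    IsHolomorphicLoopMap T r V Φ := by
  have key := fun i j => exists_coeffs_of_differentiableOn T h0 h₁ h₂ hV
    (f := fun z w => Φ z w i j)
    ((Matrix.entryLinearMap ℂ ℂ i j : Mat →ₗ[ℂ] ℂ).toContinuousLinearMap.continuous.comp_continuousOn hc)
    (fun w hw => differentiableOn_mat.1 (hl w hw) i j)
    (fun z hz => differentiableOn_mat.1 (hr z hz) i j)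
  have hmem : ∀ w : ℂ, ‖w‖ = r → w ∈ annulus r₁ r₂ := fun w hw => ⟨hw ▸ h₁, hw ▸ h₂⟩
  refine ⟨fun z hz => ⟨fun i j => ?_, fun w hw => hdet z hz w (hmem w hw),
    fun w hw => htw z hz w (hmem w hw)⟩, key⟩
  obtain ⟨F, -, hF⟩ := key i j
  exact ⟨F z, hF z hz⟩

lemma twist_mul (f g : ℂ → Mat) (w : ℂ) :
    twist (fun w => f w * g w) w = twist f w * twist g w := by
  have h : ∀ A B : Mat, sigma3 * (A * B) * sigma3 = sigma3 * A * sigma3 * (sigma3 * B * sigma3) := by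
    intro A B
    calc sigma3 * (A * B) * sigma3 = sigma3 * A * 1 * B * sigma3 := by
          simp only [mul_one, mul_assoc]
      _ = _ := by rw [← sigma3_mul_self]; simp only [mul_assoc]
  simp only [twist, sigma3_inv, h]

/-! ### The exponential of the Delaunay residue -/

/-- `exp(u D)` for the Delaunay residue `D`. -/
noncomputable def expDelaunay (α β : ℝ) (u w : ℂ) : Mat := NormedSpace.exp (u • delaunay α β w)

lemma differentiableOn_expDelaunay (α β : ℝ) :
    DifferentiableOn ℂ (fun p : ℂ × ℂ => expDelaunay α β p.1 p.2) (univ ×ˢ {0}ᶜ) := by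
  have h1 : DifferentiableOn ℂ (fun p : ℂ × ℂ => p.1 • delaunay α β p.2) (univ ×ˢ {0}ᶜ) := by
    have h2 : DifferentiableOn ℂ (fun p : ℂ × ℂ => delaunay α β p.2) (univ ×ˢ {0}ᶜ) :=
      (differentiableOn_delaunay α β).comp differentiableOn_snd fun p hp => hp.2
    exact differentiableOn_fst.smul h2
  intro p hp
  exact (NormedSpace.exp_analytic (𝕂 := ℂ) (p.1 • delaunay α β p.2)).differentiableAt.comp_differentiableWithinAt
    p (h1 p hp)

lemma hasDerivAt_expDelaunay (α β : ℝ) (u w : ℂ) :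
    HasDerivAt (fun u => expDelaunay α β u w) (expDelaunay α β u w * delaunay α β w) u :=
  hasDerivAt_exp_smul_const (delaunay α β w) u

lemma expDelaunay_zero (α β : ℝ) (w : ℂ) : expDelaunay α β 0 w = 1 := by
  simp [expDelaunay]

lemma expDelaunay_add (α β : ℝ) (u v w : ℂ) :
    expDelaunay α β (u + v) w = expDelaunay α β v w * expDelaunay α β u w := by
  rw [expDelaunay, add_comm, add_smul, Matrix.exp_add_of_commute]
  · rfl
  · exact ((Commute.refl _).smul_left _).smul_right _

lemma det_expDelaunay (α β : ℝ) (u w : ℂ) : (expDelaunay α β u w).det = 1 := by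
  have h : ∀ u, HasDerivAt (fun u => (expDelaunay α β u w).det) 0 u := by
    intro u
    have := hasDerivAt_det (X := fun u => expDelaunay α β u w) (B := delaunay α β w) (C := 0) (z := u)
      (by simpa using hasDerivAt_expDelaunay α β u w)
    simpa [trace_delaunay] using this
  have := is_const_of_deriv_eq_zero (fun u => (h u).differentiableAt) (fun u => (h u).deriv) u 0
  rw [this, expDelaunay_zero, Matrix.det_one]

lemma twist_expDelaunay (α β : ℝ) (u w : ℂ) :
    twist (expDelaunay α β u) w = expDelaunay α β u w := by
  rw [twist, expDelaunay, ← Matrix.exp_conj _ _ isUnit_sigma3, mul_smul_comm, smul_mul_assoc]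
  rw [show sigma3 * delaunay α β (-w) * sigma3⁻¹ = delaunay α β w from twist_delaunay α β w]
  rfl

/-! ### The logarithmic cover -/

lemma isOpen_logCover {U : Set ℂ} (hU : IsOpen U) : IsOpen (logCover U) :=
  hU.preimage Complex.continuous_exp

/-- The logarithmic cover of the model V is the plane or a half-plane, hence convex. Simple
connectivity gives a continuous l with ψ(z) = z e^{l(z)}, and v ↦ v − l(φ(e^v)) maps the model cover
continuously onto the cover of U. -/
lemma isPreconnected_logCover {U : Set ℂ} (hU : IsOpen U) (hUs : IsSimplyConnected U)
    (h0 : (0 : ℂ) ∈ U) : IsPreconnected (logCover U) := by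
  obtain ⟨V, φ, ψ, hV, hφ, hψ, hφm, hψm, hφψ, hψφ, hφ0, hψ0⟩ := exists_uniformization hU hUs h0
  have hVo : IsOpen V := by
    rcases hV with rfl | rfl
    exacts [isOpen_univ, Metric.isOpen_ball]
  have hpre : IsPreconnected (Complex.exp ⁻¹' V) := by
    rcases hV with rfl | rfl
    · rw [preimage_univ]; exact isPreconnected_univ
    · have : Complex.exp ⁻¹' Metric.ball 0 1 = {v : ℂ | v.re < 0} := by
        ext v; simp [Complex.norm_exp]
      rw [this]
      exact (convex_halfSpace_re_lt 0).isPreconnected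
  have hslope : DifferentiableOn ℂ (dslope ψ 0) U :=
    (Complex.differentiableOn_dslope (hU.mem_nhds h0)).2 hψ
  have hzs : ∀ z, z * dslope ψ 0 z = ψ z := fun z => by
    have := sub_smul_dslope ψ 0 z
    simpa [hψ0] using this
  have hinj : InjOn ψ U := fun x hx y hy h => by rw [← hφψ x hx, h, hφψ y hy]
  have hne : 0 ∉ dslope ψ 0 '' U := by
    rintro ⟨z, hz, h⟩
    by_cases hz0 : z = 0
    · rw [hz0, dslope_same] at h
      exact deriv_ne_zero_of_injOn hU hψ hinj h0 h
    · have h1 := hzs z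
      rw [h, mul_zero, ← hψ0] at h1
      exact hz0 (hinj h0 hz h1).symm
  obtain ⟨l, hlc, hl⟩ := Complex.exists_continuousOn_eqOn_exp_comp hUs hU hslope.continuousOn hne
  have hl' : ∀ z ∈ U, z * Complex.exp (l z) = ψ z := fun z hz => by
    rw [← hzs z]; congr 1; exact hl hz
  have himage : logCover U = (fun v => v - l (φ (Complex.exp v))) '' (Complex.exp ⁻¹' V) := by
    ext u
    constructor
    · intro hu
      have h1 : Complex.exp (u + l (Complex.exp u)) = ψ (Complex.exp u) := by
        rw [Complex.exp_add]; exact hl' _ hu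
      refine ⟨u + l (Complex.exp u), ?_, ?_⟩
      · rw [mem_preimage, h1]; exact hψm hu
      · simp only [h1, hφψ _ hu, add_sub_cancel_right]
    · rintro ⟨v, hv, rfl⟩
      have h1 := hφm hv
      have h2 := hl' _ h1
      rw [hψφ _ hv] at h2
      have h3 : Complex.exp (v - l (φ (Complex.exp v))) = φ (Complex.exp v) := by
        rw [Complex.exp_sub, div_eq_iff (Complex.exp_ne_zero _), h2]
      rw [logCover, mem_preimage, h3]
      exact h1
  rw [himage]
  refine hpre.image _ (continuousOn_id.sub ?_)
  exact hlc.comp (hφ.continuousOn.comp Complex.continuous_exp.continuousOn fun v hv => hv)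
    fun v hv => hφm hv

/-! ### Uniqueness of frames -/

/-- The adjugate of a `2 × 2` matrix, as a linear map. -/
noncomputable def adjL : Mat →ₗ[ℂ] Mat where
  toFun X := X.trace • (1 : Mat) - X
  map_add' X Y := by rw [Matrix.trace_add]; module
  map_smul' c X := by simp [smul_sub, smul_smul]

lemma adjL_apply (X : Mat) : adjL X = X.trace • (1 : Mat) - X := rfl

lemma mul_adjL (X : Mat) : X * adjL X = X.det • (1 : Mat) := by
  rw [adjL_apply]
  ext i j
  fin_cases i <;> fin_cases j <;>
    simp [Matrix.mul_apply, Fin.sum_univ_two, Matrix.trace_fin_two, Matrix.det_fin_two] <;> ring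

lemma adjL_mul_self (X : Mat) : adjL X * X = X.det • (1 : Mat) := by
  rw [adjL_apply]
  ext i j
  fin_cases i <;> fin_cases j <;>
    simp [Matrix.mul_apply, Fin.sum_univ_two, Matrix.trace_fin_two, Matrix.det_fin_two] <;> ring

/-- The adjugate reverses products, and the adjugate of a trace-free 2 × 2 matrix is its negative.
-/
lemma adjL_mul {X A : Mat} (hA : A.trace = 0) : adjL (X * A) = -(A * adjL X) := by
  rw [Matrix.trace_fin_two] at hA
  have hA' : A 1 1 = -A 0 0 := by linear_combination hA
  simp only [adjL_apply]
  ext i j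
  fin_cases i <;> fin_cases j <;>
    simp [Matrix.mul_apply, Fin.sum_univ_two, Matrix.trace_fin_two, hA'] <;> ring

/-- The product X adj(Y) has derivative X A adj(Y) − X A adj(Y) = 0, hence is constant, and adj(Y)
is the inverse of Y since det Y = 1. -/
lemma eq_of_hasDerivAt_mul {V : Set ℂ} (hV : IsOpen V) (hVc : IsPreconnected V) {A X Y : ℂ → Mat}
    (hA : ∀ u ∈ V, (A u).trace = 0) (hX : ∀ u ∈ V, HasDerivAt X (X u * A u) u)
    (hY : ∀ u ∈ V, HasDerivAt Y (Y u * A u) u) (hdet : ∀ u ∈ V, (Y u).det = 1)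
    {u₀ : ℂ} (hu₀ : u₀ ∈ V) (h : X u₀ = Y u₀) : ∀ u ∈ V, X u = Y u := by
  have hd : ∀ u ∈ V, HasDerivAt (fun u => X u * adjL (Y u)) 0 u := by
    intro u hu
    have h1 : HasDerivAt (fun u => adjL (Y u)) (adjL (Y u * A u)) u :=
      adjL.toContinuousLinearMap.hasFDerivAt.comp_hasDerivAt u (hY u hu)
    have h2 := (hX u hu).mul h1
    rw [adjL_mul (hA u hu), mul_neg, mul_assoc, add_neg_cancel] at h2
    exact h2
  intro u hu
  have h1 : X u * adjL (Y u) = X u₀ * adjL (Y u₀) :=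
    hV.is_const_of_deriv_eq_zero hVc
      (fun u hu => (hd u hu).differentiableAt.differentiableWithinAt)
      (fun u hu => (hd u hu).deriv) hu hu₀
  rw [h, mul_adjL, hdet u₀ hu₀, one_smul] at h1
  calc X u = X u * (adjL (Y u) * Y u) := by rw [adjL_mul_self, hdet u hu, one_smul, mul_one]
    _ = Y u := by rw [← mul_assoc, h1, one_mul]

/-- Off 0 the equation reads P' = P(N + D/z) − (D/z)P, and in Liouville's formula the traces of D/z
cancel. At 0 the derivative of the determinant vanishes by continuity. -/
lemma det_eq_one_of_gauge {U : Set ℂ} (hU : IsOpen U) (hUc : IsPreconnected U) (h0 : (0 : ℂ) ∈ U)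
    {P N : ℂ → Mat} {D : Mat} (hP : DifferentiableOn ℂ P U) (hN : ∀ z ∈ U, (N z).trace = 0)
    (hP0 : P 0 = 1)
    (hode : ∀ z ∈ U, z • deriv P z = z • (P z * N z) + (P z * D - D * P z)) :
    ∀ z ∈ U, (P z).det = 1 := by
  have hdd : DifferentiableOn ℂ (fun z => (P z).det) U := by
    simp only [Matrix.det_fin_two]
    have e := differentiableOn_mat.1 hP
    exact ((e 0 0).mul (e 1 1)).sub ((e 0 1).mul (e 1 0))
  have hne : ∀ z ∈ U, z ≠ 0 → deriv (fun z => (P z).det) z = 0 := by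
    intro z hz hz0
    have h1 : deriv P z = P z * (N z + z⁻¹ • D) + (-(z⁻¹ • D)) * P z := by
      have h2 := congrArg (fun X => z⁻¹ • X) (hode z hz)
      simp only [smul_smul, inv_mul_cancel₀ hz0, one_smul, smul_add, smul_sub] at h2
      rw [h2, mul_add, mul_smul_comm, neg_mul, smul_mul_assoc]
      abel
    have h3 : HasDerivAt P (deriv P z) z := (hP.differentiableAt (hU.mem_nhds hz)).hasDerivAt
    rw [h1] at h3
    rw [(hasDerivAt_det h3).deriv]
    simp [hN z hz]
  have hz : ∀ z ∈ U, deriv (fun z => (P z).det) z = 0 := by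
    intro z hz
    by_cases hz0 : z = 0
    · subst hz0
      have h1 := ((hdd.deriv hU).continuousOn.continuousAt (hU.mem_nhds h0)).tendsto.mono_left
        (nhdsWithin_le_nhds (s := {0}ᶜ))
      refine tendsto_nhds_unique h1 (tendsto_const_nhds.congr' ?_)
      filter_upwards [nhdsWithin_le_nhds (hU.mem_nhds h0), self_mem_nhdsWithin] with z hz hz0
      exact (hne z hz hz0).symm
    · exact hne z hz hz0
  intro z hzU
  have := hU.is_const_of_deriv_eq_zero hUc hdd hz hzU h0
  simpa [hP0] using this

end Frames

/-! ### The Delaunay gauge and the frame z^D P -/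

section Main

open scoped Matrix.Norms.Operator

/-- The gauge for a potential with a simple pole with Delaunay residue. -/
theorem exists_delaunay_gauge {U : Set ℂ} (hU : IsOpen U) (hUs : IsSimplyConnected U)
    (h0 : (0 : ℂ) ∈ U) {η : ℂ → ℂ → Mat} (hη : IsPotential U η) {α β r₁ r₂ : ℝ} (hr₁ : 0 ≤ r₁)
    (hnr : ∀ w ∈ annulus r₁ r₂, ∀ k : ℕ, (k : ℂ) ^ 2 ≠ 4 * delaunayEigSq α β w) :
    ∃ P : ℂ → ℂ → Mat, ContinuousOn (fun p : ℂ × ℂ => P p.1 p.2) (U ×ˢ annulus r₁ r₂) ∧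
      (∀ w ∈ annulus r₁ r₂, DifferentiableOn ℂ (fun z => P z w) U) ∧
      (∀ z ∈ U, DifferentiableOn ℂ (P z) (annulus r₁ r₂)) ∧
      (∀ w ∈ annulus r₁ r₂, ∀ z ∈ U, z • deriv (fun z => P z w) z =
        z • (P z w * η z w) + (P z w * delaunay α β w - delaunay α β w * P z w)) ∧
      (∀ z ∈ U, ∀ w ∈ annulus r₁ r₂, (P z w).det = 1) ∧
      ∀ z ∈ U, ∀ w ∈ annulus r₁ r₂, twist (P z) w = P z w := by
  have hSne : ∀ w ∈ annulus r₁ r₂, w ≠ 0 := fun w hw => ne_zero_of_mem_annulus hr₁ hw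
  have hjoint : DifferentiableOn ℂ (fun p : ℂ × ℂ => η p.1 p.2) (U ×ˢ annulus r₁ r₂) :=
    (differentiableOn_mat.2 hη.holo).mono (prod_mono_right fun w hw => hSne w hw)
  have hη₁ : ∀ w ∈ annulus r₁ r₂, DifferentiableOn ℂ (fun z => η z w) U := fun w hw =>
    hjoint.comp (f := fun z : ℂ => (z, w))
      (differentiableOn_id.prodMk (differentiableOn_const w)) fun z hz => ⟨hz, hw⟩
  have hη₂ : ∀ z ∈ U, DifferentiableOn ℂ (η z) (annulus r₁ r₂) := fun z hz =>
    hjoint.comp (f := fun w : ℂ => (z, w))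
      ((differentiableOn_const z).prodMk differentiableOn_id) fun w hw => ⟨hz, hw⟩
  obtain ⟨P, hPc, hP₁, hP₂, hP0, hode, huniq⟩ := exists_gauge hU hUs h0 (isOpen_annulus r₁ r₂)
    hjoint.continuousOn hη₁ hη₂ ((differentiableOn_delaunay α β).mono fun w hw => hSne w hw)
    (fun w hw => ⟨_, delaunay_mul_self α β w, fun k _ => hnr w hw k⟩)
  refine ⟨P, hPc, hP₁, hP₂, hode, fun z hz w hw => ?_, fun z hz w hw => ?_⟩
  · exact det_eq_one_of_gauge hU hUs.isPathConnected.isConnected.isPreconnected h0 (hP₁ w hw)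
      (fun z hz => hη.traceless z hz w (hSne w hw)) (hP0 w hw) (hode w hw) z hz
  -- The annulus is symmetric under λ ↦ −λ, and both η and D are fixed by σ, so the twist of P
  -- solves the same initial value problem and uniqueness applies.
  · have hw' : -w ∈ annulus r₁ r₂ := by simpa [annulus] using hw
    refine huniq w hw (fun z => twist (P z) w) ?_ ?_ ?_ z hz
    · exact ((hP₁ (-w) hw').const_mul sigma3).mul_const sigma3⁻¹
    · simp only [twist, hP0 _ hw', sigma3_inv, mul_one, sigma3_mul_self]
    · intro z hz
      have hd : HasDerivAt (fun z => P z (-w)) (deriv (fun z => P z (-w)) z) z :=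
        ((hP₁ (-w) hw').differentiableAt (hU.mem_nhds hz)).hasDerivAt
      have hd2 : deriv (fun z => twist (P z) w) z =
          sigma3 * deriv (fun z => P z (-w)) z * sigma3⁻¹ :=
        ((hd.const_mul sigma3).mul_const sigma3⁻¹).deriv
      have hηt := hη.twisted z hz w (hSne w hw)
      have hDt := twist_delaunay α β w
      have h1 : twist (fun v => P z v * η z v) w = twist (P z) w * η z w := by
        rw [twist_mul, hηt]
      have h2 : twist (fun v => P z v * delaunay α β v) w = twist (P z) w * delaunay α β w := by
        rw [twist_mul, hDt]
      have h3 : twist (fun v => delaunay α β v * P z v) w = delaunay α β w * twist (P z) w := by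
        rw [twist_mul, hDt]
      have h4 : z • deriv (fun z => P z (-w)) z = z • (P z (-w) * η z (-w)) +
          (P z (-w) * delaunay α β (-w) - delaunay α β (-w) * P z (-w)) := hode (-w) hw' z hz
      have h5 : z • deriv (fun z => twist (P z) w) z = z • (twist (P z) w * η z w) +
          (twist (P z) w * delaunay α β w - delaunay α β w * twist (P z) w) := by
        rw [hd2, ← h1, ← h2, ← h3, ← smul_mul_assoc, ← mul_smul_comm, h4]
        simp only [twist, mul_add, add_mul, mul_sub, sub_mul, mul_smul_comm, smul_mul_assoc]
      exact h5

/-- The term E D₀ P from differentiating E cancels against the −D₀ P in the gauge equation, leaving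
E P (D₀ + e^u N), the pulled-back potential. -/
lemma hasDerivAt_frame {N P E : ℂ → Mat} {D₀ P' : Mat} {u : ℂ}
    (hE : HasDerivAt E (E u * D₀) u) (hP : HasDerivAt P P' (Complex.exp u))
    (hode : Complex.exp u • P' = Complex.exp u • (P (Complex.exp u) * N (Complex.exp u)) +
      (P (Complex.exp u) * D₀ - D₀ * P (Complex.exp u))) :
    HasDerivAt (fun u => E u * P (Complex.exp u))
      (E u * P (Complex.exp u) *
        (Complex.exp u • ((Complex.exp u)⁻¹ • D₀ + N (Complex.exp u)))) u := by
  have h1 := hE.mul (hP.scomp u (Complex.hasDerivAt_exp u))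
  convert! h1 using 1
  rw [hode, smul_add, smul_smul, mul_inv_cancel₀ (Complex.exp_ne_zero u), one_smul]
  simp only [mul_add, mul_sub, mul_smul_comm, Function.comp, mul_assoc]
  abel

/-- The frame `z^D P` in the logarithmic coordinate. -/
theorem frame_properties {U : Set ℂ} (hU : IsOpen U) {ξ η : ℂ → ℂ → Mat} {α β r₁ r₂ : ℝ}
    (hr₁ : 0 ≤ r₁)
    (hξη : ∀ z ∈ U \ {0}, ∀ w : ℂ, w ≠ 0 → ξ z w = z⁻¹ • delaunay α β w + η z w)
    {P : ℂ → ℂ → Mat} (hPc : ContinuousOn (fun p : ℂ × ℂ => P p.1 p.2) (U ×ˢ annulus r₁ r₂))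
    (hP₁ : ∀ w ∈ annulus r₁ r₂, DifferentiableOn ℂ (fun z => P z w) U)
    (hP₂ : ∀ z ∈ U, DifferentiableOn ℂ (P z) (annulus r₁ r₂))
    (hode : ∀ w ∈ annulus r₁ r₂, ∀ z ∈ U, z • deriv (fun z => P z w) z =
        z • (P z w * η z w) + (P z w * delaunay α β w - delaunay α β w * P z w)) :
    ContinuousOn (fun p : ℂ × ℂ => zPow (delaunay α β) P p.1 p.2)
        (logCover U ×ˢ annulus r₁ r₂) ∧
      (∀ u ∈ logCover U, DifferentiableOn ℂ (zPow (delaunay α β) P u) (annulus r₁ r₂)) ∧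
      (∀ w ∈ annulus r₁ r₂, ∀ u ∈ logCover U, HasDerivAt (fun u => zPow (delaunay α β) P u w)
        (zPow (delaunay α β) P u w * pullbackExp ξ u w) u) := by
  have hSne : ∀ w ∈ annulus r₁ r₂, w ≠ 0 := fun w hw => ne_zero_of_mem_annulus hr₁ hw
  have hE := differentiableOn_expDelaunay α β
  refine ⟨?_, fun u hu => ?_, fun w hw u hu => ?_⟩
  · have h1 : ContinuousOn (fun p : ℂ × ℂ => P (Complex.exp p.1) p.2)
        (logCover U ×ˢ annulus r₁ r₂) :=
      hPc.comp (f := fun p : ℂ × ℂ => (Complex.exp p.1, p.2)) (by fun_prop)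
        fun p hp => ⟨hp.1, hp.2⟩
    exact (hE.continuousOn.mono (prod_mono (subset_univ _) hSne)).mul h1
  · have h1 : DifferentiableOn ℂ (fun w => expDelaunay α β u w) (annulus r₁ r₂) :=
      hE.comp (f := fun w : ℂ => (u, w)) ((differentiableOn_const u).prodMk differentiableOn_id)
        fun w hw => ⟨mem_univ u, hSne w hw⟩
    exact h1.mul (hP₂ _ hu)
  · have hPd : HasDerivAt (fun z => P z w) (deriv (fun z => P z w) (Complex.exp u))
        (Complex.exp u) := ((hP₁ w hw).differentiableAt (hU.mem_nhds hu)).hasDerivAt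
    have h1 := hasDerivAt_frame (N := fun z => η z w) (hasDerivAt_expDelaunay α β u w) hPd
      (hode w hw _ hu)
    rw [← hξη _ ⟨hu, Complex.exp_ne_zero u⟩ w (hSne w hw)] at h1
    exact h1

lemma isHolomorphicLoopMap_frame (T : LoopTopology) {V : Set ℂ} (hV : IsOpen V) {r₁ r r₂ : ℝ}
    (hr₁ : 0 ≤ r₁) (h₁ : r₁ < r) (h₂ : r < r₂) {Φ A : ℂ → ℂ → Mat}
    (hc : ContinuousOn (fun p : ℂ × ℂ => Φ p.1 p.2) (V ×ˢ annulus r₁ r₂))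
    (hΦ₂ : ∀ u ∈ V, DifferentiableOn ℂ (Φ u) (annulus r₁ r₂))
    (hder : ∀ w ∈ annulus r₁ r₂, ∀ u ∈ V, HasDerivAt (fun u => Φ u w) (Φ u w * A u w) u)
    (hdet : ∀ u ∈ V, ∀ w ∈ annulus r₁ r₂, (Φ u w).det = 1)
    (htw : ∀ u ∈ V, ∀ w ∈ annulus r₁ r₂, twist (Φ u) w = Φ u w) :
    IsHolomorphicLoopMap T r V Φ :=
  isHolomorphicLoopMap_of_differentiableOn T hr₁ h₁ h₂ hV hc
    (fun w hw u hu => (hder w hw u hu).differentiableAt.differentiableWithinAt) hΦ₂ hdet htw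

lemma isHolomorphicLoopMap_expDelaunay (T : LoopTopology) (α β : ℝ) {r₁ r r₂ : ℝ}
    (hr₁ : 0 ≤ r₁) (h₁ : r₁ < r) (h₂ : r < r₂) :
    IsHolomorphicLoopMap T r univ (expDelaunay α β) := by
  have hne : annulus r₁ r₂ ⊆ {0}ᶜ := fun w hw => ne_zero_of_mem_annulus hr₁ hw
  have hE := (differentiableOn_expDelaunay α β).mono (prod_mono_right hne)
  exact isHolomorphicLoopMap_frame T isOpen_univ hr₁ h₁ h₂ (A := fun _ => delaunay α β)
    hE.continuousOn
    (fun u _ => hE.comp (f := fun w : ℂ => (u, w))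
      ((differentiableOn_const u).prodMk differentiableOn_id) fun w hw => ⟨mem_univ u, hw⟩)
    (fun w _ u _ => hasDerivAt_expDelaunay α β u w)
    (fun u _ w _ => det_expDelaunay α β u w) (fun u _ w _ => twist_expDelaunay α β u w)

end Main

end LoopODE

theorem mainTheorem9
    (U : Set ℂ) (hUo : IsOpen U) (hUs : IsSimplyConnected U) (h0 : (0 : ℂ) ∈ U)
    (ξ : ℂ → ℂ → LoopODE.Mat) (hξ : LoopODE.IsPotential (U \ {0}) ξ)
    (α β : ℝ) (hα : α ≠ 0) (hβ : β ≠ 0)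
    (hres : LoopODE.HasSimplePoleWithResidue U ξ (LoopODE.delaunay α β))
    (hclosing : LoopODE.FirstClosing (LoopODE.delaunayMonodromy α β)) :
    ∃ r : ℝ, 0 < r ∧ r < 1 ∧ ∃ P : ℂ → ℂ → LoopODE.Mat, ∀ T : LoopODE.LoopTopology,
      LoopODE.IsHolomorphicLoopMap T r U P ∧
      LoopODE.IsHolomorphicFrame T r (LoopODE.logCover U) (LoopODE.pullbackExp ξ)
        (LoopODE.zPow (LoopODE.delaunay α β) P) ∧
      LoopODE.IsMonodromy T r (LoopODE.logCover U) (LoopODE.zPow (LoopODE.delaunay α β) P)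
        (2 * (Real.pi : ℂ) * Complex.I) (LoopODE.delaunayMonodromy α β) ∧
      ((1 : ℂ) ∈ U →
        (∀ lam : ℂ, ‖lam‖ = r → LoopODE.zPow (LoopODE.delaunay α β) P 0 lam = P 1 lam) ∧
        ∀ Φ : ℂ → ℂ → LoopODE.Mat,
          LoopODE.IsHolomorphicFrame T r (LoopODE.logCover U) (LoopODE.pullbackExp ξ) Φ →
          (∀ lam : ℂ, ‖lam‖ = r → Φ 0 lam = P 1 lam) →
          ∀ w ∈ LoopODE.logCover U, ∀ lam : ℂ, ‖lam‖ = r →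
            Φ w lam = LoopODE.zPow (LoopODE.delaunay α β) P w lam) := by
  obtain ⟨η, hη, hξη⟩ := hres
  -- The radius and the gauge depend only on nonresonance and on the differential equation, so both
  -- are fixed before any topology `T` is introduced.
  obtain ⟨r₁, r, r₂, hr₁, h₁, h₂, hr1, hnr⟩ := LoopODE.exists_nonresonant_annulus hα hβ
  obtain ⟨P, hPc, hP₁, hP₂, hode, hdet, htw⟩ :=
    LoopODE.exists_delaunay_gauge hUo hUs h0 hη (α := α) (β := β) hr₁ hnr
  have hr : 0 < r := hr₁.trans_lt h₁
  have hSr : ∀ w : ℂ, ‖w‖ = r → w ∈ LoopODE.annulus r₁ r₂ := fun w hw => ⟨hw ▸ h₁, hw ▸ h₂⟩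
  obtain ⟨hc, hd₂, hder⟩ := LoopODE.frame_properties hUo hr₁ hξη hPc hP₁ hP₂ hode
  have hopen := LoopODE.isOpen_logCover hUo
  have hdetΨ : ∀ u ∈ LoopODE.logCover U, ∀ w ∈ LoopODE.annulus r₁ r₂,
      (LoopODE.zPow (LoopODE.delaunay α β) P u w).det = 1 := fun u hu w hw => by
    have h := LoopODE.det_expDelaunay α β u w
    rw [LoopODE.expDelaunay] at h
    rw [LoopODE.zPow, Matrix.det_mul, hdet _ hu w hw, h, one_mul]
  have hper : ∀ u : ℂ, Complex.exp (u + 2 * (Real.pi : ℂ) * Complex.I) = Complex.exp u :=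
    Complex.exp_periodic
  refine ⟨r, hr, hr1, P, fun T => ⟨?_, ⟨?_, ?_⟩, ⟨?_, ?_⟩, fun h1U => ⟨?_, ?_⟩⟩⟩
  · exact LoopODE.isHolomorphicLoopMap_of_differentiableOn T hr₁ h₁ h₂ hUo hPc hP₁ hP₂ hdet htw
  · refine LoopODE.isHolomorphicLoopMap_frame T hopen hr₁ h₁ h₂ hc hd₂ hder hdetΨ
      fun u hu w hw => ?_
    refine (LoopODE.twist_mul (LoopODE.expDelaunay α β u) (P (Complex.exp u)) w).trans ?_
    rw [LoopODE.twist_expDelaunay, htw _ hu w hw]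
    rfl
  · exact fun u hu w hw i j => LoopODE.hasDerivAt_mat (hder w (hSr w hw) u hu) i j
  · exact (LoopODE.isHolomorphicLoopMap_expDelaunay T α β hr₁ h₁ h₂).mem _ (mem_univ _)
  -- The factor P(e^u) is 2πi-periodic in u, so only exp(uD) contributes to the monodromy.
  · intro u hu
    refine ⟨?_, fun w hw => ?_⟩
    · rw [LoopODE.logCover, mem_preimage, hper]; exact hu
    · have h := LoopODE.expDelaunay_add α β u (2 * (Real.pi : ℂ) * Complex.I) w
      simp only [LoopODE.expDelaunay] at h
      rw [LoopODE.zPow, LoopODE.zPow, hper, h, LoopODE.delaunayMonodromy, mul_assoc]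
  · intro w _
    rw [LoopODE.zPow, zero_smul, NormedSpace.exp_zero, Complex.exp_zero, one_mul]
  · intro Φ hΦ hΦ0 u hu w hw
    have h0' : (0 : ℂ) ∈ LoopODE.logCover U := by
      rw [LoopODE.logCover, mem_preimage, Complex.exp_zero]; exact h1U
    refine LoopODE.eq_of_hasDerivAt_mul hopen (LoopODE.isPreconnected_logCover hUo hUs h0)
      (A := fun u => LoopODE.pullbackExp ξ u w) (X := fun u => Φ u w)
      (Y := fun u => LoopODE.zPow (LoopODE.delaunay α β) P u w) ?_
      (fun u hu => LoopODE.hasDerivAt_of_entries (hΦ.ode u hu w hw)) (hder w (hSr w hw))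
      (fun u hu => hdetΨ u hu w (hSr w hw)) h0' ?_ u hu
    · intro u hu
      have hw0 : w ≠ 0 := LoopODE.ne_zero_of_mem_annulus hr₁ (hSr w hw)
      rw [LoopODE.pullbackExp, Matrix.trace_smul,
        hξ.traceless _ ⟨hu, Complex.exp_ne_zero u⟩ w hw0, smul_zero]
    · simp only [hΦ0 w hw, LoopODE.zPow, zero_smul, NormedSpace.exp_zero, Complex.exp_zero, one_mul]
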